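/- Consider a sequence, indexed by $t\in\mathbb N$, of linear regression problems $Y=\sum_{k=1}^p X_k\beta_k+\varepsilon$ with $n\ge 1$ observations and $p$ groups of covariates, where $X_k$ is a real $n\times d_k$ matrix, $d_k\ge 1$ and $\beta_k\in\mathbb R^{d_k}$; all quantities below may depend on $t$, the index being suppressed. For $\lambda\ge 0$, a group Lasso estimate $\hat\beta=(\hat\beta_1,\dots,\hat\beta_p)$ is a minimizer over $b=(b_1,\dots,b_p)$ of $\frac12\|Y-\sum_k X_kb_k\|_2^2+\lambda\sum_{k}\sqrt{d_k}\,\|b_k\|_2$. Assume: (i) $\varepsilon_1,\dots,\varepsilon_n$ are independent $N(0,\sigma^2)$ variables, $\sigma>0$; (ii) (generalized sparsity) $A_0\subset\{1,\dots,p\}$ and $\eta_1\ge 0$ satisfy $\sum_{k\in A_0}\|\beta_k\|_2\le\eta_1$, and $q=\#\{k: k\notin A_0\}\ge 1$; (iii) (sparse Riesz condition) $q^*\le p$, $0<c_*<c^*<\infty$, and for all $A\subset\{1,\dots,p\}$ with $|A|=q^*$ and all $\nu=(\nu_k)_{k\in A}$ with $\nu_k\in\mathbb R^{d_k}$, $c_*\,n\|\nu\|_2^2\le\|\sum_{k\in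 A}X_k\nu_k\|_2^2\le c^*\,n\|\nu\|_2^2$. Let $d_a=\max_k d_k$, $d_b=\min_k d_k$, $d=d_a/d_b$, $N_d=\sum_k d_k$, $\bar c=c^*/c_*$, $\eta_2=\max_{A\subset A_0}\|\sum_{k\in A}X_k\beta_k\|_2$, and, for $\lambda>0$, $$r_1=\Big(\frac{nc^*\sqrt{d_a}\,\eta_1}{\lambda d_b q}\Big)^{1/2},\quad r_2=\Big(\frac{nc^*\eta_2^2}{\lambda^2d_bq}\Big)^{1/2},\quad B_1(\lambda)=\Big(\frac{\lambda^2d_b^2q}{nc^*}\Big)^{1/2},$$ $$M_1(\lambda)=2+4r_1^2+4\sqrt{d\bar c}\,r_2+4d\bar c,$$ $$M_2(\lambda)=\tfrac23\big(1+4r_1^2+2d\bar c+4\sqrt{2d}(1+\sqrt{\bar c})\sqrt{\bar c}\,r_2+\tfrac{16}{3}d\bar c^2\big),$$ $$M_3(\lambda)=\tfrac23\big(1+4r_1^2+4\sqrt{d\bar c}(1+2\sqrt{1+\bar c})r_2+3r_2^2+\tfrac23d\bar c(7+4\bar c)\big).$$ Let $c_0\ge 0$ and $a\ge 0$ be such that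 $p\,d_a/(N_d\vee a)^{1+c_0}\to 0$ as $t\to\infty$, and put $$\lambda_{n,p}=2\sigma\sqrt{8(1+c_0)\,d_a d^2 q^*\bar c\, n c^*\log(N_d\vee a)},\qquad \lambda_0=\inf\{\lambda>0: M_1(\lambda)q+1\le q^*\}\quad(\inf\varnothing=\infty).$$ If $\lambda\ge\max\{\lambda_0,\lambda_{n,p}\}$ for every $t$, then, with probability tending to $1$ as $t\to\infty$, every group Lasso estimate $\hat\beta$ at penalty level $\lambda$ satisfies $$\#\{k:\|\hat\beta_k\|_2>0\}\le\#\{k:\|\hat\beta_k\|_2>0\text{ or }k\notin A_0\}\le M_1(\lambda)\,q,$$ $$\Big\|(I-\hat P)\sum_{k=1}^p X_k\beta_k\Big\|_2^2\le M_2(\lambda)B_1^2(\lambda),$$ $$\zeta_2^2=\sum_{k\notin A_0}\|\beta_k\|_2^2\,I\{\|\hat\beta_k\|_2=0\}\le\frac{M_3(\lambda)B_1^2(\lambda)}{c_*n},$$ where $\hat P$ is the orthogonal projection of $\mathbb R^n$ onto the span of the columns of the $X_k$ with $\|\hat\beta_k\|_2>0$. -/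

import Mathlib

open MeasureTheory ProbabilityTheory Filter Topology

/-- The deterministic data of a grouped linear regression problem together with the tuning
quantities that enter the bounds. Everything here is plain data: no condition is imposed. -/
structure GroupModel where
  /-- sample size -/
  n : ℕ
  /-- number of groups -/
  p : ℕ
  /-- group sizes -/
  d : Fin p → ℕ
  /-- covariate submatrix of each group -/
  X : (k : Fin p) → Matrix (Fin n) (Fin (d k)) ℝ
  /-- the true coefficients, group by group -/
  β : (k : Fin p) → EuclideanSpace ℝ (Fin (d k))
  /-- the set of unimportant groups -/
  A₀ : Finset (Fin p)
  /-- level of the generalized sparsity condition -/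
  η₁ : ℝ
  /-- rank of the sparse Riesz condition -/
  qStar : ℕ
  /-- lower spectrum bound -/
  cLow : ℝ
  /-- upper spectrum bound -/
  cUp : ℝ
  /-- noise standard deviation -/
  σ : ℝ
  /-- constant in the penalty level -/
  c₀ : ℝ
  /-- constant in the penalty level -/
  a : ℝ

namespace GroupModel

noncomputable section

variable (M : GroupModel)

/-- Coefficient vectors, split into groups; each group carries its Euclidean norm. -/
abbrev Coef : Type := (k : Fin M.p) → EuclideanSpace ℝ (Fin (M.d k))

/-- The partial mean vector `∑ k ∈ A, X_k b_k`, that is `X_A b_A`. -/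
def partialFit (A : Finset (Fin M.p)) (b : M.Coef) : EuclideanSpace ℝ (Fin M.n) :=
  ∑ k ∈ A, Matrix.toEuclideanLin (M.X k) (b k)

/-- The mean vector `X b`. -/
def fit (b : M.Coef) : EuclideanSpace ℝ (Fin M.n) := M.partialFit Finset.univ b

/-- The response `Y = X β + e` for a realization `e` of the errors. -/
def response (e : Fin M.n → ℝ) : EuclideanSpace ℝ (Fin M.n) :=
  M.fit M.β + WithLp.toLp 2 e

/-- The group Lasso criterion at penalty level `ℓ`. -/
def objective (Y : EuclideanSpace ℝ (Fin M.n)) (ℓ : ℝ) (b : M.Coef) : ℝ :=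
  1 / 2 * ‖Y - M.fit b‖ ^ 2 + ℓ * ∑ k, √(M.d k : ℝ) * ‖b k‖

/-- `b` is a group Lasso estimate: a minimizer of the group Lasso criterion. -/
def IsGroupLasso (Y : EuclideanSpace ℝ (Fin M.n)) (ℓ : ℝ) (b : M.Coef) : Prop :=
  ∀ b' : M.Coef, M.objective Y ℓ b ≤ M.objective Y ℓ b'

/-- The number of important groups. -/
def q : ℕ := (M.A₀ᶜ).card

/-- Generalized sparsity condition. -/
def GSC : Prop := ∑ k ∈ M.A₀, ‖M.β k‖ ≤ M.η₁

/-- Sparse Riesz condition with rank `qStar` and spectrum bounds `cLow`, `cUp`: the bounds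
`cLow ≤ ‖X_A ν‖² / (n ‖ν‖²) ≤ cUp` for all `A` with `qStar` elements, cleared of denominators.
Only the components `ν k` with `k ∈ A` matter. -/
def SRC : Prop :=
  ∀ A : Finset (Fin M.p), A.card = M.qStar → ∀ ν : M.Coef,
    M.cLow * (M.n * ∑ k ∈ A, ‖ν k‖ ^ 2) ≤ ‖M.partialFit A ν‖ ^ 2 ∧
      ‖M.partialFit A ν‖ ^ 2 ≤ M.cUp * (M.n * ∑ k ∈ A, ‖ν k‖ ^ 2)

/-- The groups selected by `b`. -/
def selected (b : M.Coef) : Finset (Fin M.p) := Finset.univ.filter fun k => 0 < ‖b k‖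

/-- The linear span of the columns of the groups in `A`. -/
def colSpan (A : Finset (Fin M.p)) : Submodule ℝ (EuclideanSpace ℝ (Fin M.n)) :=
  ⨆ k ∈ A, LinearMap.range (Matrix.toEuclideanLin (M.X k))

/-- `‖(I - P̂) X β‖`, where `P̂` is the orthogonal projection onto the span of the groups
selected by `b`. -/
def omegaTilde (b : M.Coef) : ℝ :=
  ‖M.fit M.β - (M.colSpan (M.selected b)).starProjection (M.fit M.β)‖

/-- The square root of the sum of `‖β_k‖²` over the important groups that `b` does not select. -/
def zeta2 (b : M.Coef) : ℝ :=
  √(∑ k ∈ M.A₀ᶜ, ‖M.β k‖ ^ 2 * if ‖b k‖ = 0 then 1 else 0)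

/-- The largest group size. -/
def da : ℕ := ⨆ k, M.d k

/-- The smallest group size. -/
def db : ℕ := ⨅ k, M.d k

/-- The ratio of the largest to the smallest group size. -/
def dRatio : ℝ := M.da / M.db

/-- The total number of covariates. -/
def Nd : ℕ := ∑ k, M.d k

/-- The condition number `cUp / cLow`. -/
def cBar : ℝ := M.cUp / M.cLow

/-- The maximum of `‖∑ k ∈ A, X_k β_k‖` over all `A ⊆ A₀`. -/
def η₂ : ℝ :=
  M.A₀.powerset.sup' ⟨∅, Finset.empty_mem_powerset _⟩ fun A => ‖M.partialFit A M.β‖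

def r₁ (ℓ : ℝ) : ℝ := √(M.n * M.cUp * √(M.da : ℝ) * M.η₁ / (ℓ * M.db * M.q))

def r₂ (ℓ : ℝ) : ℝ := √(M.n * M.cUp * M.η₂ ^ 2 / (ℓ ^ 2 * M.db * M.q))

def M₁ (ℓ : ℝ) : ℝ :=
  2 + 4 * M.r₁ ℓ ^ 2 + 4 * √(M.dRatio * M.cBar) * M.r₂ ℓ + 4 * M.dRatio * M.cBar

def M₂ (ℓ : ℝ) : ℝ :=
  2 / 3 * (1 + 4 * M.r₁ ℓ ^ 2 + 2 * M.dRatio * M.cBar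
    + 4 * √(2 * M.dRatio) * (1 + √M.cBar) * √M.cBar * M.r₂ ℓ
    + 16 / 3 * M.dRatio * M.cBar ^ 2)

def M₃ (ℓ : ℝ) : ℝ :=
  2 / 3 * (1 + 4 * M.r₁ ℓ ^ 2
    + 4 * √(M.dRatio * M.cBar) * (1 + 2 * √(1 + M.cBar)) * M.r₂ ℓ + 3 * M.r₂ ℓ ^ 2
    + 2 / 3 * M.dRatio * M.cBar * (7 + 4 * M.cBar))

def B₁ (ℓ : ℝ) : ℝ := √(ℓ ^ 2 * (M.db : ℝ) ^ 2 * M.q / (M.n * M.cUp))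

/-- The number `N_d ∨ a`. -/
def NdMax : ℝ := max (M.Nd : ℝ) M.a

/-- The penalty level determined by the noise. -/
def lamNP : ℝ :=
  2 * M.σ * √(8 * (1 + M.c₀) * M.da * M.dRatio ^ 2 * M.qStar * M.cBar * M.n * M.cUp
    * Real.log M.NdMax)

/-- The infimum of the penalty levels `ℓ > 0` with `M₁(ℓ) q + 1 ≤ qStar`; it is `⊤` when there
is none. -/
def lam0 : EReal :=
  sInf ((fun ℓ : ℝ => (ℓ : EReal)) '' {ℓ : ℝ | 0 < ℓ ∧ M.M₁ ℓ * M.q + 1 ≤ M.qStar})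

end

end GroupModel

/-! The only random input is one event: every column score |⟨x_j, ε⟩| is at most `noiseLevel` =: τ.
On it ‖X_kᵀε‖ ≤ τ√d_k, and the choice of `lamNP` gives 16 d_a d² q* c̄ τ² ≤ λ². All else is
deterministic.

Optimality says that the score X_kᵀ(Y − Xb) has norm at most λ√d_k, with equality ("saturation")
when b_k ≠ 0. Suppose A contains the important groups, supports b, has at most q* elements, and
consists of saturated groups apart from the important ones. Pairing the residual with X(β − b) and
using the lower Riesz bound on A gives a quadratic inequality for ‖X(β − b)‖
(`sq_norm_pred_sub_le`), so its square is at most a constant times λ²d_b q/(nc*). Conversely, a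
saturated group has a large score, which the small noise cannot supply; by the upper Riesz bound the
prediction error therefore limits the number of such groups (`card_saturated_mul_le`). Together: |A|
≤ q* implies |A| ≤ M₁q ≤ q* − 1.

This is circular, since |A| ≤ q* is assumed. The circle is broken by continuity along the solution
path (`card_support_le_of_path`). For a huge penalty b = 0 and A may be the set of important groups.
As the penalty decreases to λ, the gap between q* − 1 and q* prevents the size from escaping: at the
smallest penalty reached, the whole saturated set is still small, and the solution restricted to it
stays globally optimal slightly further down. Since `M₁` decreases in the penalty, one bound serves
the whole path.

With A in hand, the bounds with `M₂` and `M₃` follow from the quadratic inequality and the lower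
Riesz bound. The event has probability tending to 1 by a Gaussian tail bound and a union bound over
at most p·d_a columns. -/

set_option linter.unusedSectionVars false

/-! ### Optimality conditions and existence for the penalized criterion -/

namespace GroupLasso

section

variable {ι : Type*} [Fintype ι] {E : ι → Type*}
  [∀ k, NormedAddCommGroup (E k)] [∀ k, InnerProductSpace ℝ (E k)]
  {F : Type*} [NormedAddCommGroup F] [InnerProductSpace ℝ F]

/-- The linear predictor of a grouped coefficient vector. -/
def pred (T : ∀ k, E k →ₗ[ℝ] F) (b : ∀ k, E k) : F := ∑ k, T k (b k)

/-- The weighted group penalty. -/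
def pen (w : ι → ℝ) (b : ∀ k, E k) : ℝ := ∑ k, w k * ‖b k‖

/-- The penalized least squares criterion. -/
noncomputable def crit (T : ∀ k, E k →ₗ[ℝ] F) (w : ι → ℝ) (Y : F) (l : ℝ) (b : ∀ k, E k) : ℝ :=
  1 / 2 * ‖Y - pred T b‖ ^ 2 + l * pen w b

/-- Vectors that vanish outside the groups in `A`. -/
def supported {ι : Type*} (E : ι → Type*) [∀ k, NormedAddCommGroup (E k)] (A : Finset ι) :
    Set (∀ k, E k) := {b | ∀ k ∉ A, b k = 0}

lemma convex_supported (A : Finset ι) : Convex ℝ (supported E A) := by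
  intro x hx y hy s t _ _ _ k hk
  simp [hx k hk, hy k hk]

lemma isClosed_supported (A : Finset ι) : IsClosed (supported E A) := by
  have : supported E A = ⋂ k, ⋂ (_ : k ∉ A), {b | b k = 0} := by
    ext b; simp [supported]
  rw [this]
  exact isClosed_iInter fun k => isClosed_iInter fun _ =>
    isClosed_eq (continuous_apply k) continuous_const

variable {T : ∀ k, E k →ₗ[ℝ] F} {w : ι → ℝ} {Y : F} {l : ℝ} {b c : ∀ k, E k}

lemma pred_add (b c : ∀ k, E k) : pred T (b + c) = pred T b + pred T c := by
  simp [pred, Finset.sum_add_distrib]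

lemma pred_sub (b c : ∀ k, E k) : pred T (b - c) = pred T b - pred T c := by
  simp [pred, Finset.sum_sub_distrib]

lemma pred_smul (t : ℝ) (b : ∀ k, E k) : pred T (t • b) = t • pred T b := by
  simp [pred, Finset.smul_sum]

lemma pen_nonneg (hw : ∀ k, 0 ≤ w k) (b : ∀ k, E k) : 0 ≤ pen w b :=
  Finset.sum_nonneg fun k _ => mul_nonneg (hw k) (norm_nonneg _)

lemma pen_segment_le (hw : ∀ k, 0 ≤ w k) {t : ℝ} (h0 : 0 ≤ t) (h1 : t ≤ 1) :
    pen w (b + t • (c - b)) ≤ pen w b + t * (pen w c - pen w b) := by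
  have : pen w b + t * (pen w c - pen w b)
      = ∑ k, w k * ((1 - t) * ‖b k‖ + t * ‖c k‖) := by
    simp only [pen, ← Finset.sum_sub_distrib, Finset.mul_sum, ← Finset.sum_add_distrib]
    exact Finset.sum_congr rfl fun k _ => by ring
  rw [this]
  refine Finset.sum_le_sum fun k _ => mul_le_mul_of_nonneg_left ?_ (hw k)
  have e : (b + t • (c - b)) k = (1 - t) • b k + t • c k := by
    simp only [Pi.add_apply, Pi.smul_apply, Pi.sub_apply]
    module
  rw [e]
  refine (norm_add_le _ _).trans_eq ?_
  rw [norm_smul, norm_smul, Real.norm_of_nonneg h0, Real.norm_of_nonneg (sub_nonneg.2 h1)]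

lemma crit_add (h : ∀ k, E k) :
    crit T w Y l (b + h) = crit T w Y l b - inner ℝ (Y - pred T b) (pred T h)
      + 1 / 2 * ‖pred T h‖ ^ 2 + l * (pen w (b + h) - pen w b) := by
  have : Y - pred T (b + h) = (Y - pred T b) - pred T h := by
    rw [pred_add]; abel
  rw [crit, this, norm_sub_sq_real, crit]
  ring

/-- First order condition for a minimizer over a convex set. -/
lemma inner_residual_le (hw : ∀ k, 0 ≤ w k) (hl : 0 ≤ l) {K : Set (∀ k, E k)}
    (hK : Convex ℝ K) (hb : b ∈ K) (hmin : IsMinOn (crit T w Y l) K b) (hc : c ∈ K) :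
    inner ℝ (Y - pred T b) (pred T (c - b)) ≤ l * (pen w c - pen w b) := by
  have key : ∀ t : ℝ, 0 < t → t ≤ 1 →
      inner ℝ (Y - pred T b) (pred T (c - b)) - l * (pen w c - pen w b)
        ≤ t * (1 / 2 * ‖pred T (c - b)‖ ^ 2) := by
    intro t h0 h1
    have hm : b + t • (c - b) ∈ K := hK.add_smul_sub_mem hb hc ⟨h0.le, h1⟩
    have h2 : crit T w Y l b ≤ crit T w Y l (b + t • (c - b)) := hmin hm
    rw [crit_add, pred_smul, inner_smul_right, norm_smul, mul_pow, Real.norm_of_nonneg h0.le] at h2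
    have h3 := mul_le_mul_of_nonneg_left (pen_segment_le (b := b) (c := c) hw h0.le h1) hl
    refine le_of_mul_le_mul_left ?_ h0
    nlinarith
  by_contra! hcon
  set x := inner ℝ (Y - pred T b) (pred T (c - b)) - l * (pen w c - pen w b) with hx
  have hx0 : 0 < x := by linarith
  set y := 1 / 2 * ‖pred T (c - b)‖ ^ 2 with hy
  have hy0 : 0 ≤ y := by positivity
  -- This t makes t·y < x; the +1 keeps the quotient defined when y = 0.
  have h4 := key (min 1 (x / (2 * (y + 1)))) (by positivity) (min_le_left _ _)
  have h5 : min 1 (x / (2 * (y + 1))) * y ≤ x / (2 * (y + 1)) * y :=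
    mul_le_mul_of_nonneg_right (min_le_right _ _) hy0
  have h6 : x / (2 * (y + 1)) * y < x := by
    rw [div_mul_eq_mul_div, div_lt_iff₀ (by positivity)]
    nlinarith
  linarith

/-- The loss is exactly quadratic in the prediction, so the first order condition self-improves to
quadratic growth in the prediction. Uniqueness of the fit and continuity along the path both come
from this. -/
lemma crit_add_sq_le (h : inner ℝ (Y - pred T b) (pred T (c - b)) ≤ l * (pen w c - pen w b)) :
    crit T w Y l b + 1 / 2 * ‖pred T (c - b)‖ ^ 2 ≤ crit T w Y l c := by
  have := crit_add (T := T) (w := w) (Y := Y) (l := l) (b := b) (c - b)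
  rw [add_sub_cancel] at this
  linarith

lemma continuous_pen : Continuous (fun b : ∀ k, E k => pen w b) := by
  unfold pen; fun_prop

/-- Minimizers of the criterion. -/
def IsSol (T : ∀ k, E k →ₗ[ℝ] F) (w : ι → ℝ) (Y : F) (l : ℝ) (b : ∀ k, E k) : Prop :=
  ∀ c, crit T w Y l b ≤ crit T w Y l c

lemma IsSol.isMinOn (hb : IsSol T w Y l b) : IsMinOn (crit T w Y l) Set.univ b :=
  fun x _ => hb x

lemma IsSol.inner_le (hw : ∀ k, 0 ≤ w k) (hl : 0 ≤ l) (hb : IsSol T w Y l b) (c : ∀ k, E k) :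
    inner ℝ (Y - pred T b) (pred T (c - b)) ≤ l * (pen w c - pen w b) :=
  inner_residual_le hw hl convex_univ (Set.mem_univ _) hb.isMinOn (Set.mem_univ _)

lemma IsSol.pred_eq (hw : ∀ k, 0 ≤ w k) (hl : 0 ≤ l) (hb : IsSol T w Y l b)
    (hc : IsSol T w Y l c) : pred T b = pred T c := by
  have h1 := crit_add_sq_le (hb.inner_le hw hl c)
  have h2 := hc b
  have h3 : ‖pred T (c - b)‖ = 0 := by nlinarith [sq_nonneg ‖pred T (c - b)‖]
  rw [norm_eq_zero, pred_sub, sub_eq_zero] at h3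
  exact h3.symm

lemma pen_le_of_crit_le_zero (hl : 0 < l) (h : crit T w Y l b ≤ crit T w Y l 0) :
    pen w b ≤ ‖Y‖ ^ 2 / (2 * l) := by
  have : crit T w Y l (0 : ∀ k, E k) = 1 / 2 * ‖Y‖ ^ 2 := by simp [crit, pred, pen]
  rw [this, crit] at h
  rw [le_div_iff₀ (by positivity)]
  nlinarith [sq_nonneg ‖Y - pred T b‖]

lemma norm_le_of_pen_le (hw : ∀ k, 0 < w k) {R : ℝ} (h : pen w b ≤ R) (k : ι) :
    ‖b k‖ ≤ R / w k := by
  rw [le_div_iff₀ (hw k), mul_comm]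
  refine le_trans ?_ h
  exact Finset.single_le_sum (f := fun k => w k * ‖b k‖)
    (fun i _ => mul_nonneg (hw i).le (norm_nonneg _)) (Finset.mem_univ k)

section FiniteDimensional

variable [∀ k, FiniteDimensional ℝ (E k)] [FiniteDimensional ℝ F]

lemma continuous_pred : Continuous (pred T) := by
  unfold pred
  have := fun k => (T k).continuous_of_finiteDimensional
  fun_prop

lemma continuous_crit : Continuous (fun x : ℝ × (∀ k, E k) => crit T w Y x.1 x.2) := by
  unfold crit
  have := continuous_pred (T := T)
  have := continuous_pen (E := E) (w := w)
  fun_prop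

lemma isCompact_pen_le (hw : ∀ k, 0 < w k) (R : ℝ) : IsCompact {b : ∀ k, E k | pen w b ≤ R} := by
  have : ∀ k, ProperSpace (E k) := fun k => FiniteDimensional.proper ℝ _
  refine (isCompact_univ_pi fun k => isCompact_closedBall (0 : E k) (R / w k)).of_isClosed_subset
    (isClosed_le continuous_pen continuous_const) ?_
  intro b hb k _
  simpa using norm_le_of_pen_le hw hb k

lemma exists_isMinOn_crit (hw : ∀ k, 0 < w k) (hl : 0 < l) {K : Set (∀ k, E k)}
    (hK : IsClosed K) (h0 : (0 : ∀ k, E k) ∈ K) : ∃ b ∈ K, IsMinOn (crit T w Y l) K b := by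
  have hcomp := (isCompact_pen_le (E := E) hw (‖Y‖ ^ 2 / (2 * l))).inter_right hK
  have hz : (0 : ∀ k, E k) ∈ {b : ∀ k, E k | pen w b ≤ ‖Y‖ ^ 2 / (2 * l)} ∩ K :=
    ⟨pen_le_of_crit_le_zero (T := T) hl le_rfl, h0⟩
  obtain ⟨b, hb, hmin⟩ := hcomp.exists_isMinOn ⟨0, hz⟩
    ((continuous_crit (T := T) (w := w) (Y := Y)).comp (Continuous.prodMk_right l)).continuousOn
  refine ⟨b, hb.2, fun c hc => ?_⟩
  by_cases h : pen w c ≤ ‖Y‖ ^ 2 / (2 * l)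
  · exact hmin ⟨h, hc⟩
  · have h1 : crit T w Y l b ≤ crit T w Y l 0 := hmin hz
    have h2 : ¬ crit T w Y l c ≤ crit T w Y l 0 := fun h' => h (pen_le_of_crit_le_zero hl h')
    exact (h1.trans (not_le.1 h2).le)

/-- The group score: the gradient of the negative least squares loss. -/
noncomputable def score (T : ∀ k, E k →ₗ[ℝ] F) (Y : F) (b : ∀ k, E k) (k : ι) : E k :=
  LinearMap.adjoint (T k) (Y - pred T b)

lemma inner_score (k : ι) (v : E k) :
    inner ℝ (score T Y b k) v = inner ℝ (Y - pred T b) (T k v) :=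
  LinearMap.adjoint_inner_left _ _ _

lemma inner_residual_pred (c : ∀ k, E k) :
    inner ℝ (Y - pred T b) (pred T c) = ∑ k, inner ℝ (score T Y b k) (c k) := by
  change inner ℝ _ (∑ k, T k (c k)) = _
  rw [inner_sum]
  exact Finset.sum_congr rfl fun k _ => (inner_score k (c k)).symm

lemma isSol_of_score (h1 : ∀ k, ‖score T Y b k‖ ≤ l * w k)
    (h2 : ∀ k, inner ℝ (score T Y b k) (b k) = l * w k * ‖b k‖) : IsSol T w Y l b := by
  intro c
  have : inner ℝ (Y - pred T b) (pred T (c - b)) ≤ l * (pen w c - pen w b) := by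
    rw [inner_residual_pred, pen, pen, ← Finset.sum_sub_distrib, Finset.mul_sum]
    refine Finset.sum_le_sum fun k _ => ?_
    rw [Pi.sub_apply, inner_sub_right, h2]
    have := (real_inner_le_norm (score T Y b k) (c k)).trans
      (mul_le_mul_of_nonneg_right (h1 k) (norm_nonneg _))
    linarith
  have := crit_add_sq_le this
  nlinarith [sq_nonneg ‖pred T (c - b)‖]

section

variable [DecidableEq ι]

lemma pred_single (k : ι) (v : E k) : pred T (Pi.single k v) = T k v := by
  rw [pred, Finset.sum_eq_single k]
  · simp
  · intro j _ hj; simp [Pi.single_eq_of_ne hj]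
  · simp

lemma pen_update (k : ι) (v : E k) :
    pen w (Function.update b k v) - pen w b = w k * (‖v‖ - ‖b k‖) := by
  rw [pen, pen, ← Finset.sum_sub_distrib, Finset.sum_eq_single k]
  · simp [mul_sub]
  · intro j _ hj; simp [hj]
  · simp

/-- Stated for a convex set in which group k can move freely, so that it serves both global
minimizers and minimizers supported on A. The tests v = score and v = −b_k then give the two
optimality conditions. -/
lemma inner_score_le (hw : ∀ k, 0 ≤ w k) (hl : 0 ≤ l) {K : Set (∀ k, E k)}
    (hK : Convex ℝ K) (hb : b ∈ K) (hmin : IsMinOn (crit T w Y l) K b) {k : ι}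
    (hk : ∀ v, Function.update b k v ∈ K) (v : E k) :
    inner ℝ (score T Y b k) v ≤ l * w k * (‖b k + v‖ - ‖b k‖) := by
  have h := inner_residual_le hw hl hK hb hmin (hk (b k + v))
  have e : Function.update b k (b k + v) - b = Pi.single k v := by
    ext j
    by_cases hj : j = k
    · subst hj; simp
    · simp [hj]
  rw [pen_update, e, pred_single, ← inner_score] at h
  linarith

lemma norm_score_le_of_isMinOn (hw : ∀ k, 0 ≤ w k) (hl : 0 ≤ l) {K : Set (∀ k, E k)}
    (hK : Convex ℝ K) (hb : b ∈ K) (hmin : IsMinOn (crit T w Y l) K b) {k : ι}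
    (hk : ∀ v, Function.update b k v ∈ K) : ‖score T Y b k‖ ≤ l * w k := by
  have h := inner_score_le hw hl hK hb hmin hk (score T Y b k)
  rw [real_inner_self_eq_norm_sq] at h
  have h1 := norm_add_le (b k) (score T Y b k)
  have h2 : 0 ≤ l * w k := mul_nonneg hl (hw k)
  by_contra! hcon
  have h3 := mul_le_mul_of_nonneg_left h1 h2
  nlinarith

lemma inner_score_eq_of_isMinOn (hw : ∀ k, 0 ≤ w k) (hl : 0 ≤ l) {K : Set (∀ k, E k)}
    (hK : Convex ℝ K) (hb : b ∈ K) (hmin : IsMinOn (crit T w Y l) K b) {k : ι}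
    (hk : ∀ v, Function.update b k v ∈ K) :
    inner ℝ (score T Y b k) (b k) = l * w k * ‖b k‖ := by
  apply le_antisymm
  · exact (real_inner_le_norm _ _).trans (mul_le_mul_of_nonneg_right
      (norm_score_le_of_isMinOn hw hl hK hb hmin hk) (norm_nonneg _))
  · have h := inner_score_le hw hl hK hb hmin hk (-b k)
    simp only [inner_neg_right, add_neg_cancel, norm_zero] at h
    linarith

lemma IsSol.norm_score_le (hw : ∀ k, 0 ≤ w k) (hl : 0 ≤ l) (hb : IsSol T w Y l b) (k : ι) :
    ‖score T Y b k‖ ≤ l * w k := by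
  have h1 : Convex ℝ (Set.univ : Set (∀ k, E k)) := convex_univ
  have h2 := hb.isMinOn
  have h3 : ∀ v, Function.update b k v ∈ (Set.univ : Set (∀ k, E k)) := fun v => trivial
  have h4 : b ∈ (Set.univ : Set (∀ k, E k)) := trivial
  exact norm_score_le_of_isMinOn hw hl h1 h4 h2 h3

lemma IsSol.inner_score_eq (hw : ∀ k, 0 ≤ w k) (hl : 0 ≤ l) (hb : IsSol T w Y l b) (k : ι) :
    inner ℝ (score T Y b k) (b k) = l * w k * ‖b k‖ := by
  have h1 : Convex ℝ (Set.univ : Set (∀ k, E k)) := convex_univ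
  have h2 := hb.isMinOn
  have h3 : ∀ v, Function.update b k v ∈ (Set.univ : Set (∀ k, E k)) := fun v => trivial
  have h4 : b ∈ (Set.univ : Set (∀ k, E k)) := trivial
  exact inner_score_eq_of_isMinOn hw hl h1 h4 h2 h3

/-- The score of an active group has the maximal length. -/
lemma IsSol.norm_score_eq (hw : ∀ k, 0 ≤ w k) (hl : 0 ≤ l) (hb : IsSol T w Y l b) {k : ι}
    (hk : b k ≠ 0) : ‖score T Y b k‖ = l * w k := by
  refine le_antisymm (hb.norm_score_le hw hl k) ?_
  have h := real_inner_le_norm (score T Y b k) (b k)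
  rw [hb.inner_score_eq hw hl k] at h
  exact le_of_mul_le_mul_right h (norm_pos_iff.2 hk)

lemma update_mem_supported {A : Finset ι} (hb : b ∈ supported E A) {k : ι} (hk : k ∈ A)
    (v : E k) : Function.update b k v ∈ supported E A := by
  intro j hj
  have : j ≠ k := fun h => hj (h ▸ hk)
  simp [this, hb j hj]

end

end FiniteDimensional

end

end GroupLasso

set_option linter.unusedSectionVars false

/-! ### Continuation along the solution path -/

namespace GroupLasso

section

variable {ι : Type*} [Fintype ι] [DecidableEq ι] {E : ι → Type*}
  [∀ k, NormedAddCommGroup (E k)] [∀ k, InnerProductSpace ℝ (E k)]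
  [∀ k, FiniteDimensional ℝ (E k)]
  {F : Type*} [NormedAddCommGroup F] [InnerProductSpace ℝ F] [FiniteDimensional ℝ F]
  {T : ∀ k, E k →ₗ[ℝ] F} {w : ι → ℝ} {Y : F} {l : ℝ} {b c : ∀ k, E k}

open Classical in
/-- The groups in `B` together with those whose score has the maximal length. -/
noncomputable def saturated (T : ∀ k, E k →ₗ[ℝ] F) (w : ι → ℝ) (Y : F) (B : Finset ι) (l : ℝ)
    (b : ∀ k, E k) : Finset ι :=
  Finset.univ.filter fun k => k ∈ B ∨ ‖score T Y b k‖ = l * w k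

-- The implication "at most m + 1 gives at most m" rules out size exactly m + 1, and subsets of
-- saturated groups can be given any intermediate size.
open Classical in
lemma card_saturated_le (hw : ∀ k, 0 ≤ w k) (hl : 0 ≤ l) {B : Finset ι} {m : ℕ}
    (hb : IsSol T w Y l b)
    (H : ∀ A, B ⊆ A → b ∈ supported E A → (∀ k ∈ A, k ∉ B → ‖score T Y b k‖ = l * w k) →
      A.card ≤ m + 1 → A.card ≤ m)
    {A : Finset ι} (hBA : B ⊆ A) (hbA : b ∈ supported E A) (hA : A.card ≤ m) :
    (saturated T w Y B l b).card ≤ m := by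
  by_contra! hcon
  set S : Finset ι := Finset.univ.filter fun k => k ∈ B ∨ b k ≠ 0 with hS
  have hSA : S ⊆ A := by
    intro k hk
    rcases (Finset.mem_filter.1 hk).2 with h | h
    · exact hBA h
    · by_contra hkA
      exact h (hbA k hkA)
  have hSsat : S ⊆ saturated T w Y B l b := by
    intro k hk
    refine Finset.mem_filter.2 ⟨Finset.mem_univ _, ?_⟩
    rcases (Finset.mem_filter.1 hk).2 with h | h
    · exact Or.inl h
    · exact Or.inr (hb.norm_score_eq hw hl h)
  -- S is the smallest admissible set and has at most m elements; a set of exactly m + 1 elements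
  -- fits between S and the saturated set.
  obtain ⟨A', h1, h2, h3⟩ := Finset.exists_subsuperset_card_eq hSsat
    (((Finset.card_le_card hSA).trans hA).trans (Nat.le_succ m)) hcon
  have h4 := H A' (fun k hk => h1 (by simp [hS, hk]))
    (fun k hk => by
      by_contra h
      exact hk (h1 (by simp [hS, h])))
    (fun k hk hkB => ((Finset.mem_filter.1 (h2 hk)).2).resolve_left hkB) h3.le
  omega

/-- Predictions of restricted minimizers depend continuously on the penalty level. -/
lemma norm_pred_sub_sq_le (hw : ∀ k, 0 ≤ w k) {l' R : ℝ} (hl' : 0 ≤ l') (hll : l' ≤ l)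
    {K : Set (∀ k, E k)} (hK : Convex ℝ K) (hb : b ∈ K) (hc : c ∈ K)
    (hbmin : IsMinOn (crit T w Y l) K b) (hcmin : IsMinOn (crit T w Y l') K c)
    (hR : pen w c ≤ R) : ‖pred T c - pred T b‖ ^ 2 ≤ (l - l') * R := by
  have h1 := crit_add_sq_le (inner_residual_le hw (hl'.trans hll) hK hb hbmin hc)
  have h2 := crit_add_sq_le (inner_residual_le hw hl' hK hc hcmin hb)
  rw [pred_sub] at h1 h2
  rw [norm_sub_rev] at h2
  have h3 : 0 ≤ (l - l') * pen w b := mul_nonneg (by linarith) (pen_nonneg hw b)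
  have h4 : (l - l') * pen w c ≤ (l - l') * R := mul_le_mul_of_nonneg_left hR (by linarith)
  simp only [crit] at h1 h2
  linarith

lemma isSol_zero_of_large (hw : ∀ k, 0 < w k) :
    ∃ L : ℝ, ∀ l, L ≤ l → IsSol T w Y l (0 : ∀ k, E k) := by
  refine ⟨∑ k, ‖score T Y (0 : ∀ k, E k) k‖ / w k, fun l hl => isSol_of_score (fun k => ?_) ?_⟩
  · rw [← div_le_iff₀ (hw k)]
    refine le_trans ?_ hl
    exact Finset.single_le_sum (f := fun k => ‖score T Y (0 : ∀ k, E k) k‖ / w k)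
      (fun i _ => div_nonneg (norm_nonneg _) (hw i).le) (Finset.mem_univ k)
  · intro k; simp

/-- Minimize over vectors supported on A at a slightly smaller penalty. The prediction barely moves,
so the strict score inequalities off A survive and the restricted minimizer is a global one. -/
lemma exists_isSol_lt (hw : ∀ k, 0 < w k) {l₀ : ℝ} (hl₀ : 0 < l₀) (hl : l₀ < l)
    (hb : IsSol T w Y l b) {A : Finset ι} (hbA : b ∈ supported E A)
    (hA : ∀ k ∉ A, ‖score T Y b k‖ ≠ l * w k) :
    ∃ l' c, l₀ ≤ l' ∧ l' < l ∧ IsSol T w Y l' c ∧ c ∈ supported E A := by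
  have hw0 : ∀ k, 0 ≤ w k := fun k => (hw k).le
  set R := ‖Y‖ ^ 2 / (2 * l₀) with hR
  let D : ∀ k, F →L[ℝ] E k := fun k => (LinearMap.adjoint (T k)).toContinuousLinearMap
  -- The square root bounds the change in prediction and vanishes at l' = l, where the inequality is
  -- strict.
  have hev : ∀ᶠ l' in 𝓝 l, ∀ k ∈ Finset.univ \ A,
      ‖score T Y b k‖ + ‖D k‖ * √((l - l') * R) < l' * w k := by
    rw [Filter.eventually_all_finset]
    intro k hk
    have hkA : k ∉ A := by simpa using hk
    have hlt : ‖score T Y b k‖ < l * w k :=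
      lt_of_le_of_ne (hb.norm_score_le hw0 (hl₀.trans hl).le k) (hA k hkA)
    refine Filter.Tendsto.eventually_lt (y := ‖score T Y b k‖) (z := l * w k) ?_ ?_ hlt
    · have : ContinuousAt (fun l' => ‖score T Y b k‖ + ‖D k‖ * √((l - l') * R)) l := by fun_prop
      have h := this.tendsto
      simpa using h
    · exact (continuous_id.mul continuous_const).tendsto l
  have hev2 : ∀ᶠ l' in 𝓝[<] l, l₀ < l' ∧ l' < l :=
    (eventually_nhdsWithin_of_eventually_nhds (lt_mem_nhds hl)).and self_mem_nhdsWithin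
  obtain ⟨l', h1, h2, h3⟩ := ((eventually_nhdsWithin_of_eventually_nhds hev).and hev2).exists
  have hl' : 0 < l' := hl₀.trans h2
  have hK : Convex ℝ (supported E A) := convex_supported A
  obtain ⟨c, hc, hcmin⟩ := exists_isMinOn_crit (T := T) (Y := Y) hw hl' (isClosed_supported A)
    (show (0 : ∀ k, E k) ∈ supported E A from fun k _ => rfl)
  refine ⟨l', c, h2.le, h3, ?_, hc⟩
  have hpen : pen w c ≤ R := by
    refine (pen_le_of_crit_le_zero hl' (hcmin fun k _ => rfl)).trans ?_
    exact div_le_div_of_nonneg_left (sq_nonneg _) (by positivity) (by linarith)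
  have hbmin : IsMinOn (crit T w Y l) (supported E A) b := fun x _ => hb x
  have hpred := norm_pred_sub_sq_le hw0 hl'.le h3.le hK hbA hc hbmin hcmin hpen
  refine isSol_of_score (fun k => ?_) (fun k => ?_)
  · by_cases hk : k ∈ A
    · exact norm_score_le_of_isMinOn hw0 hl'.le hK hc hcmin (update_mem_supported hc hk)
    · refine le_trans ?_ (h1 k (by simp [hk])).le
      have e : score T Y c k = score T Y b k - D k (pred T c - pred T b) := by
        change score T Y c k = score T Y b k - LinearMap.adjoint (T k) (pred T c - pred T b)
        rw [score, score, ← map_sub]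
        congr 1; abel
      rw [e]
      refine (norm_sub_le _ _).trans (add_le_add le_rfl ?_)
      refine ((D k).le_opNorm _).trans (mul_le_mul_of_nonneg_left ?_ (norm_nonneg _))
      exact Real.le_sqrt_of_sq_le hpred
  · by_cases hk : k ∈ A
    · exact inner_score_eq_of_isMinOn hw0 hl'.le hK hc hcmin (update_mem_supported hc hk)
    · simp [hc k hk]

lemma isClosed_isSol : IsClosed {x : ℝ × (∀ k, E k) | IsSol T w Y x.1 x.2} := by
  have : {x : ℝ × (∀ k, E k) | IsSol T w Y x.1 x.2}
      = ⋂ c, {x : ℝ × (∀ k, E k) | crit T w Y x.1 x.2 ≤ crit T w Y x.1 c} := by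
    ext x; simp [IsSol]
  rw [this]
  have h1 := continuous_crit (T := T) (w := w) (Y := Y)
  refine isClosed_iInter fun c => ?_
  have h3 : Continuous fun x : ℝ × (∀ k, E k) => crit T w Y x.1 c := by
    unfold crit; fun_prop
  exact isClosed_le h1 h3

/-- A sparsity bound that improves itself along the solution path holds on the whole path. -/
theorem card_support_le_of_path (hw : ∀ k, 0 < w k) {l₀ : ℝ} (hl₀ : 0 < l₀) {B : Finset ι} {m : ℕ}
    (hB : B.card ≤ m)
    (H : ∀ l, l₀ ≤ l → ∀ b, IsSol T w Y l b → ∀ A, B ⊆ A → b ∈ supported E A →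
      (∀ k ∈ A, k ∉ B → ‖score T Y b k‖ = l * w k) → A.card ≤ m + 1 → A.card ≤ m)
    (hb : IsSol T w Y l₀ b) :
    ∃ A, B ⊆ A ∧ (∀ k ∈ A, k ∈ B ∨ ‖score T Y b k‖ = l₀ * w k) ∧ b ∈ supported E A ∧
      A.card ≤ m := by
  classical
  have hw0 : ∀ k, 0 ≤ w k := fun k => (hw k).le
  obtain ⟨L, hL⟩ := isSol_zero_of_large (T := T) (Y := Y) hw
  set R := ‖Y‖ ^ 2 / (2 * l₀) with hR
  let S : Set (ℝ × (∀ k, E k)) := {x | IsSol T w Y x.1 x.2}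
  let Q : Set (∀ k, E k) := ⋃ A ∈ Finset.univ.filter (fun A : Finset ι => B ⊆ A ∧ A.card ≤ m),
    supported E A
  have hQ : IsClosed Q := isClosed_biUnion_finset fun A _ => isClosed_supported A
  have hmemQ : ∀ x, x ∈ Q ↔ ∃ A : Finset ι, B ⊆ A ∧ A.card ≤ m ∧ x ∈ supported E A := by
    intro x; simp [Q, and_assoc]
  have hS : IsClosed S := isClosed_isSol
  have hcomp : IsCompact ((Set.Icc l₀ (max l₀ L) ×ˢ {b : ∀ k, E k | pen w b ≤ R}) ∩
      (S ∩ Prod.snd ⁻¹' Q)) :=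
    (isCompact_Icc.prod (isCompact_pen_le hw R)).inter_right
      (hS.inter (hQ.preimage continuous_snd))
  have hpenR : ∀ l, l₀ ≤ l → ∀ c : ∀ k, E k, IsSol T w Y l c → pen w c ≤ R := by
    intro l hl c hc
    refine (pen_le_of_crit_le_zero (hl₀.trans_le hl) (hc 0)).trans ?_
    exact div_le_div_of_nonneg_left (sq_nonneg _) (by positivity) (by linarith)
  have hz : IsSol T w Y (max l₀ L) (0 : ∀ k, E k) := hL _ (le_max_right _ _)
  -- Smallest penalty level in [l₀, max l₀ L] having a sparse solution; the zero solution at the top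
  -- shows that there is one.
  obtain ⟨⟨l₁, b₁⟩, ⟨⟨⟨h1, h1'⟩, -⟩, h3, h4⟩, hmin⟩ := hcomp.exists_isMinOn
    ⟨(max l₀ L, 0), ⟨⟨⟨le_max_left _ _, le_rfl⟩, hpenR _ (le_max_left _ _) _ hz⟩, hz,
      (hmemQ _).2 ⟨B, le_rfl, hB, fun _ _ => rfl⟩⟩⟩ continuous_fst.continuousOn
  have h1 : l₀ ≤ l₁ := h1
  have h1' : l₁ ≤ max l₀ L := h1'
  have h3 : IsSol T w Y l₁ b₁ := h3
  obtain ⟨A, hBA, hAm, hbA⟩ := (hmemQ _).1 h4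
  have hl₁ : 0 < l₁ := hl₀.trans_le h1
  have hsat := card_saturated_le hw0 hl₁.le h3 (fun A => H l₁ h1 b₁ h3 A) hBA hbA hAm
  have hmemsat : ∀ c : ∀ k, E k, IsSol T w Y l₁ c → c ∈ supported E (saturated T w Y B l₁ c) := by
    intro c hc k hk
    by_contra h
    exact hk (Finset.mem_filter.2 ⟨Finset.mem_univ _, Or.inr (hc.norm_score_eq hw0 hl₁.le h)⟩)
  rcases h1.eq_or_lt with h | h
  · subst h
    -- The given solution may differ from b₁, but all solutions share one prediction, hence the
    -- scores and the saturated set.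
    have e : saturated T w Y B l₀ b = saturated T w Y B l₀ b₁ := by
      have : score T Y b = score T Y b₁ := by
        funext k
        rw [score, score, hb.pred_eq hw0 hl₁.le h3]
      rw [saturated, saturated, this]
    refine ⟨saturated T w Y B l₀ b, ?_, ?_, hmemsat b hb, e ▸ hsat⟩
    · intro k hk
      exact Finset.mem_filter.2 ⟨Finset.mem_univ _, Or.inl hk⟩
    · intro k hk
      exact (Finset.mem_filter.1 hk).2
  · exfalso
    -- Continuing on the whole saturated set, whose size is at most m, contradicts the minimality of
    -- l₁.
    obtain ⟨l', c, h5, h6, h7, h8⟩ := exists_isSol_lt hw hl₀ h h3 (hmemsat b₁ h3)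
      (fun k hk hk' => hk (Finset.mem_filter.2 ⟨Finset.mem_univ _, Or.inr hk'⟩))
    have h9 : (l', c) ∈ (Set.Icc l₀ (max l₀ L) ×ˢ {b : ∀ k, E k | pen w b ≤ R}) ∩
        (S ∩ Prod.snd ⁻¹' Q) := by
      refine ⟨⟨⟨h5, h6.le.trans h1'⟩, hpenR l' h5 c h7⟩, h7, (hmemQ _).2 ⟨_, ?_, hsat, h8⟩⟩
      intro k hk
      exact Finset.mem_filter.2 ⟨Finset.mem_univ _, Or.inl hk⟩
    have h10 : l₁ ≤ l' := hmin h9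
    linarith

end

end GroupLasso

set_option linter.unusedSectionVars false

/-! ### Prediction error versus number of saturated groups -/

namespace GroupLasso

section

variable {ι : Type*} [Fintype ι] [DecidableEq ι] {E : ι → Type*}
  [∀ k, NormedAddCommGroup (E k)] [∀ k, InnerProductSpace ℝ (E k)]
  [∀ k, FiniteDimensional ℝ (E k)]
  {F : Type*} [NormedAddCommGroup F] [InnerProductSpace ℝ F] [FiniteDimensional ℝ F]
  {T : ∀ k, E k →ₗ[ℝ] F} {w : ι → ℝ} {Y : F} {l : ℝ} {b : ∀ k, E k}

lemma sum_weight_mul_norm_le {A S : Finset ι} (hSA : S ⊆ A) {W cl : ℝ} (hcl : 0 < cl)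
    (hW : ∀ k, w k ^ 2 ≤ W) {ν : ∀ k, E k} {y : ℝ} (hy : 0 ≤ y)
    (hν : cl * ∑ k ∈ A, ‖ν k‖ ^ 2 ≤ y ^ 2) :
    ∑ k ∈ S, w k * ‖ν k‖ ≤ √(W * S.card / cl) * y := by
  have h1 : (∑ k ∈ S, w k * ‖ν k‖) ^ 2 ≤ (∑ k ∈ S, w k ^ 2) * ∑ k ∈ S, ‖ν k‖ ^ 2 :=
    Finset.sum_mul_sq_le_sq_mul_sq _ _ _
  have h2 : ∑ k ∈ S, w k ^ 2 ≤ W * S.card := by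
    refine (Finset.sum_le_sum fun k _ => hW k).trans_eq ?_
    simp [mul_comm]
  have h3 : ∑ k ∈ S, ‖ν k‖ ^ 2 ≤ y ^ 2 / cl := by
    rw [le_div_iff₀ hcl, mul_comm]
    refine le_trans (mul_le_mul_of_nonneg_left ?_ hcl.le) hν
    exact Finset.sum_le_sum_of_subset_of_nonneg hSA fun _ _ _ => sq_nonneg _
  have h0 : 0 ≤ ∑ k ∈ S, w k ^ 2 := Finset.sum_nonneg fun _ _ => sq_nonneg _
  have h4 : (∑ k ∈ S, w k * ‖ν k‖) ^ 2 ≤ W * S.card / cl * y ^ 2 := by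
    refine h1.trans ((mul_le_mul h2 h3 (Finset.sum_nonneg fun _ _ => sq_nonneg _)
      (h0.trans h2)).trans_eq ?_)
    ring
  refine (Real.le_sqrt_of_sq_le h4).trans_eq ?_
  rw [Real.sqrt_mul (div_nonneg (h0.trans h2) hcl.le), Real.sqrt_sq hy]

/-- The basic inequality for the prediction error of a sparse group Lasso solution. -/
lemma sq_norm_pred_sub_le (hw : ∀ k, 0 ≤ w k) (hl : 0 ≤ l) {β : ∀ k, E k} {e : F}
    (hb : IsSol T w (pred T β + e) l b) {A B : Finset ι} (hBA : B ⊆ A)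
    (hbA : b ∈ supported E A) {W cl τ η : ℝ} (hcl : 0 < cl) (hW : ∀ k, w k ^ 2 ≤ W)
    (hlow : ∀ ν : ∀ k, E k, cl * ∑ k ∈ A, ‖ν k‖ ^ 2 ≤ ‖∑ k ∈ A, T k (ν k)‖ ^ 2)
    (hτ : 0 ≤ τ) (he : ∀ k, ‖LinearMap.adjoint (T k) e‖ ≤ τ * w k)
    (hη : ∑ k ∈ Bᶜ, w k * ‖β k‖ ≤ η) :
    ‖pred T (β - b)‖ ^ 2 ≤ (l + τ) * η + (l * √(W * B.card / cl) + τ * √(W * A.card / cl))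
      * ‖∑ k ∈ A, T k ((β - b) k)‖ := by
  have hη0 : ∑ k ∈ Aᶜ, w k * ‖β k‖ ≤ η := le_trans
    (Finset.sum_le_sum_of_subset_of_nonneg (Finset.compl_subset_compl.2 hBA)
      fun k _ _ => mul_nonneg (hw k) (norm_nonneg _)) hη
  have hres : pred T β + e - pred T b = pred T (β - b) + e := by
    rw [pred_sub]; abel
  have h1 : inner ℝ (pred T β + e - pred T b) (pred T (β - b))
      ≤ l * η + l * ∑ k ∈ B, w k * ‖(β - b) k‖ := by
    rw [inner_residual_pred, ← Finset.sum_add_sum_compl B, add_comm, Finset.mul_sum]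
    refine add_le_add ?_ (Finset.sum_le_sum fun k _ => ?_)
    · refine le_trans ?_ (mul_le_mul_of_nonneg_left hη hl)
      rw [Finset.mul_sum]
      refine Finset.sum_le_sum fun k _ => ?_
      -- The term −l·w_k‖b_k‖ is dropped, so groups outside B cost only their true coefficients.
      rw [Pi.sub_apply, inner_sub_right, hb.inner_score_eq hw hl k]
      have h2 := (real_inner_le_norm (score T (pred T β + e) b k) (β k)).trans
        (mul_le_mul_of_nonneg_right (hb.norm_score_le hw hl k) (norm_nonneg _))
      have h3 : 0 ≤ l * w k * ‖b k‖ := mul_nonneg (mul_nonneg hl (hw k)) (norm_nonneg _)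
      linarith
    · rw [← mul_assoc]
      exact (real_inner_le_norm _ _).trans
        (mul_le_mul_of_nonneg_right (hb.norm_score_le hw hl k) (norm_nonneg _))
  have h2 : -inner ℝ e (pred T (β - b)) ≤ τ * η + τ * ∑ k ∈ A, w k * ‖(β - b) k‖ := by
    have h3 : inner ℝ e (pred T (β - b))
        = ∑ k, inner ℝ (LinearMap.adjoint (T k) e) ((β - b) k) := by
      simp_rw [LinearMap.adjoint_inner_left]
      rw [pred, inner_sum]
    have h4 : ∀ k, -inner ℝ (LinearMap.adjoint (T k) e) ((β - b) k)
        ≤ τ * (w k * ‖(β - b) k‖) := by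
      intro k
      rw [← inner_neg_left, ← mul_assoc]
      refine (real_inner_le_norm _ _).trans
        (mul_le_mul_of_nonneg_right ?_ (norm_nonneg _))
      rw [norm_neg]
      exact he k
    rw [h3, ← Finset.sum_neg_distrib, ← Finset.sum_add_sum_compl A, add_comm, Finset.mul_sum]
    refine add_le_add ?_ (Finset.sum_le_sum fun k _ => h4 k)
    refine le_trans ?_ (mul_le_mul_of_nonneg_left hη0 hτ)
    rw [Finset.mul_sum]
    refine Finset.sum_le_sum fun k hk => ?_
    have := h4 k
    rw [Pi.sub_apply, hbA k (Finset.mem_compl.1 hk), sub_zero] at this ⊢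
    exact this
  rw [hres, inner_add_left, real_inner_self_eq_norm_sq] at h1
  have h5 := mul_le_mul_of_nonneg_left (sum_weight_mul_norm_le hBA hcl hW (norm_nonneg _)
    (hlow (β - b))) hl
  have h6 := mul_le_mul_of_nonneg_left (sum_weight_mul_norm_le subset_rfl hcl hW
    (norm_nonneg _) (hlow (β - b))) hτ
  linarith

/-- Off A the error β − b is β itself; for A containing the important groups this remainder is
controlled by η₂. -/
lemma norm_sum_le_pred_add {β : ∀ k, E k} {A : Finset ι} (hbA : b ∈ supported E A) :
    ‖∑ k ∈ A, T k ((β - b) k)‖ ≤ ‖pred T (β - b)‖ + ‖∑ k ∈ Aᶜ, T k (β k)‖ := by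
  have h : pred T (β - b) = ∑ k ∈ A, T k ((β - b) k) + ∑ k ∈ Aᶜ, T k (β k) := by
    rw [pred, ← Finset.sum_add_sum_compl A]
    congr 1
    refine Finset.sum_congr rfl fun k hk => ?_
    rw [Pi.sub_apply, hbA k (Finset.mem_compl.1 hk), sub_zero]
  rw [h]
  exact norm_le_add_norm_add _ _

/-- An upper bound for a partial design operator bounds its adjoint. -/
lemma sum_sq_norm_adjoint_le {S : Finset ι} {cu : ℝ} (hcu : 0 ≤ cu)
    (hup : ∀ ν : ∀ k, E k, ‖∑ k ∈ S, T k (ν k)‖ ^ 2 ≤ cu * ∑ k ∈ S, ‖ν k‖ ^ 2) (f : F) :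
    ∑ k ∈ S, ‖LinearMap.adjoint (T k) f‖ ^ 2 ≤ cu * ‖f‖ ^ 2 := by
  set x := ∑ k ∈ S, ‖LinearMap.adjoint (T k) f‖ ^ 2 with hx
  have h1 : x = inner ℝ f (∑ k ∈ S, T k (LinearMap.adjoint (T k) f)) := by
    rw [inner_sum, hx]
    refine Finset.sum_congr rfl fun k _ => ?_
    rw [← LinearMap.adjoint_inner_left, real_inner_self_eq_norm_sq]
  have hx0 : 0 ≤ x := Finset.sum_nonneg fun _ _ => sq_nonneg _
  have h2 := real_inner_le_norm f (∑ k ∈ S, T k (LinearMap.adjoint (T k) f))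
  rw [← h1] at h2
  have h3 := hup fun k => LinearMap.adjoint (T k) f
  rw [← hx] at h3
  have h4 : x ^ 2 ≤ ‖f‖ ^ 2 * (cu * x) := by
    refine (pow_le_pow_left₀ hx0 h2 2).trans ?_
    rw [mul_pow]
    exact mul_le_mul_of_nonneg_left h3 (sq_nonneg _)
  rcases hx0.eq_or_lt with h | h
  · rw [← h]
    exact mul_nonneg hcu (sq_nonneg _)
  · refine le_of_mul_le_mul_right ?_ h
    nlinarith

/-- The number of saturated groups is controlled by the prediction error. -/
lemma card_saturated_mul_le {β : ∀ k, E k} {e : F} {S : Finset ι} {cu τ W w₀ : ℝ}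
    (hl : 0 ≤ l) (hcu : 0 ≤ cu) (hw : ∀ k, 0 ≤ w k) (hW : ∀ k, w k ^ 2 ≤ W) (hw₀ : ∀ k, w₀ ≤ w k ^ 2)
    (hup : ∀ ν : ∀ k, E k, ‖∑ k ∈ S, T k (ν k)‖ ^ 2 ≤ cu * ∑ k ∈ S, ‖ν k‖ ^ 2)
    (he : ∀ k, ‖LinearMap.adjoint (T k) e‖ ≤ τ * w k)
    (hS : ∀ k ∈ S, ‖score T (pred T β + e) b k‖ = l * w k) :
    l ^ 2 * w₀ * S.card ≤ 3 / 2 * (cu * ‖pred T (β - b)‖ ^ 2) + 3 * (τ ^ 2 * W * S.card) := by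
  have h1 : ∀ k ∈ S, l ^ 2 * w₀ ≤ 3 / 2 * ‖LinearMap.adjoint (T k) (pred T (β - b))‖ ^ 2
      + 3 * (τ ^ 2 * W) := by
    intro k hk
    have h2 : score T (pred T β + e) b k
        = LinearMap.adjoint (T k) (pred T (β - b)) + LinearMap.adjoint (T k) e := by
      rw [score, ← map_add, pred_sub]
      congr 1; abel
    have h3 := norm_add_le (LinearMap.adjoint (T k) (pred T (β - b))) (LinearMap.adjoint (T k) e)
    rw [← h2, hS k hk] at h3
    have h4 : (l * w k) ^ 2 ≤ 3 / 2 * ‖LinearMap.adjoint (T k) (pred T (β - b))‖ ^ 2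
        + 3 * ‖LinearMap.adjoint (T k) e‖ ^ 2 := by
      refine (pow_le_pow_left₀ (mul_nonneg hl (hw k)) h3 2).trans ?_
      -- (x + y)² ≤ (3/2)x² + 3y². The weight 3/2 rather than 2 keeps the later coefficients 33/10
      -- and 15/4 below the 4 in `M₁`.
      nlinarith [sq_nonneg (‖LinearMap.adjoint (T k) (pred T (β - b))‖
        - 2 * ‖LinearMap.adjoint (T k) e‖)]
    have h5 : ‖LinearMap.adjoint (T k) e‖ ^ 2 ≤ τ ^ 2 * W := by
      refine (pow_le_pow_left₀ (norm_nonneg _) (he k) 2).trans ?_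
      rw [mul_pow]
      exact mul_le_mul_of_nonneg_left (hW k) (sq_nonneg _)
    have h6 : l ^ 2 * w₀ ≤ (l * w k) ^ 2 := by
      rw [mul_pow]
      exact mul_le_mul_of_nonneg_left (hw₀ k) (sq_nonneg _)
    linarith
  have h7 := Finset.sum_le_sum h1
  rw [Finset.sum_add_distrib, Finset.sum_const, Finset.sum_const, nsmul_eq_mul, nsmul_eq_mul,
    ← Finset.mul_sum] at h7
  have h8 := sum_sq_norm_adjoint_le hcu hup (pred T (β - b))
  linarith

end

/-- Solving the basic inequality for the prediction error. -/
lemma sq_le_of_basic {B a R r z y : ℝ} (hB : 0 ≤ B) (ha : 1 ≤ a)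
    (hr : 0 ≤ r) (h1 : z ^ 2 ≤ 11 / 10 * (R * B ^ 2) + (a * B + B / 4) * y)
    (h2 : y ≤ z + r * B) (hz : 0 ≤ z) :
    z ^ 2 ≤ (11 / 5 * R + 25 / 16 * a ^ 2 + 5 / 2 * (a * r)) * B ^ 2 := by
  have h3 : (a * B + B / 4) * y ≤ 5 / 4 * (a * B) * (z + r * B) := by
    have h4 : a * B + B / 4 ≤ 5 / 4 * (a * B) := by nlinarith
    have h5 : 0 ≤ z + r * B := by positivity
    calc (a * B + B / 4) * y ≤ (a * B + B / 4) * (z + r * B) :=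
          mul_le_mul_of_nonneg_left h2 (by positivity)
      _ ≤ _ := mul_le_mul_of_nonneg_right h4 h5
  nlinarith [sq_nonneg (z - 5 / 4 * (a * B))]

/-- Solving the basic inequality for the estimation error. -/
lemma sq_le_of_basic' {B a R r z y : ℝ} (hB : 0 ≤ B) (ha : 1 ≤ a)
    (hr : 0 ≤ r) (h1 : z ^ 2 ≤ 11 / 10 * (R * B ^ 2) + (a * B + B / 4) * y)
    (h2 : y ≤ z + r * B) (hy : 0 ≤ y) :
    y ^ 2 ≤ (2 / 3 + 8 / 3 * R + 44 / 9 * a ^ 2 + 8 * (a * r) + 2 * r ^ 2) * B ^ 2 := by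
  have h0 : 0 ≤ r * B := mul_nonneg hr hB
  have h3 : (a * B + B / 4) * y ≤ (a + 1 / 4) * B * z + (a + 1 / 4) * r * B ^ 2 :=
    calc (a * B + B / 4) * y ≤ (a * B + B / 4) * (z + r * B) :=
          mul_le_mul_of_nonneg_left h2 (by positivity)
      _ = _ := by ring
  have h4 : y ^ 2 ≤ 2 * z ^ 2 + 2 * (r * B) ^ 2 := by
    refine (pow_le_pow_left₀ hy h2 2).trans ?_
    nlinarith [sq_nonneg (z - r * B)]
  -- The split 7/40 leaves 33/40 of z², so that 2·(40/33)·(11/10) = 8/3, exactly the coefficient of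
  -- r₁² in `M₃`.
  have h5 : (a + 1 / 4) * B * z ≤ 7 / 40 * z ^ 2 + 10 / 7 * ((a + 1 / 4) * B) ^ 2 := by
    nlinarith [sq_nonneg (7 / 20 * z - (a + 1 / 4) * B)]
  have h6 : 33 / 40 * z ^ 2 ≤ (11 / 10 * R + 10 / 7 * (a + 1 / 4) ^ 2 + (a + 1 / 4) * r) * B ^ 2 := by
    linarith
  -- Here a ≥ 1 is essential: the inequality fails on an interval below 1.
  have h7 : 2 * (40 / 33) * (10 / 7) * (a + 1 / 4) ^ 2 ≤ 2 / 3 + 44 / 9 * a ^ 2 := by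
    nlinarith
  have h8 : 2 * (40 / 33) * ((a + 1 / 4) * r) ≤ 8 * (a * r) := by nlinarith
  have h9 : 2 * (40 / 33) * (11 / 10 * R + 10 / 7 * (a + 1 / 4) ^ 2 + (a + 1 / 4) * r)
      ≤ 2 / 3 + 8 / 3 * R + 44 / 9 * a ^ 2 + 8 * (a * r) := by linarith
  have h10 := mul_le_mul_of_nonneg_right h9 (sq_nonneg B)
  linarith

end GroupLasso

/-! ### The regression model and its constants -/

namespace GroupModel

open GroupLasso

/-- The standing assumptions on the deterministic data of the model. -/
structure Regular (M : GroupModel) : Prop where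
  one_le_n : 1 ≤ M.n
  one_le_d : ∀ k, 1 ≤ M.d k
  one_le_q : 1 ≤ M.q
  qStar_le : M.qStar ≤ M.p
  eta_nonneg : 0 ≤ M.η₁
  cLow_pos : 0 < M.cLow
  cLow_lt : M.cLow < M.cUp
  gsc : M.GSC
  src : M.SRC

/-- The design operator of a group. -/
noncomputable def design (M : GroupModel) (k : Fin M.p) :
    EuclideanSpace ℝ (Fin (M.d k)) →ₗ[ℝ] EuclideanSpace ℝ (Fin M.n) :=
  Matrix.toEuclideanLin (M.X k)

/-- The penalty weight of a group. -/
noncomputable def weight (M : GroupModel) (k : Fin M.p) : ℝ := √(M.d k : ℝ)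

variable {M : GroupModel} {l : ℝ}

lemma isGroupLasso_iff {Y : EuclideanSpace ℝ (Fin M.n)} {b : M.Coef} :
    M.IsGroupLasso Y l b ↔ IsSol M.design M.weight Y l b := Iff.rfl

lemma weight_sq (k : Fin M.p) : M.weight k ^ 2 = M.d k := Real.sq_sqrt (Nat.cast_nonneg _)

lemma d_le_da (k : Fin M.p) : M.d k ≤ M.da := le_ciSup (Finite.bddAbove_range M.d) k

lemma db_le_d (k : Fin M.p) : M.db ≤ M.d k := ciInf_le (Finite.bddBelow_range M.d) k

lemma weight_nonneg (k : Fin M.p) : 0 ≤ M.weight k := Real.sqrt_nonneg _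

namespace Regular

lemma weight_pos (h : M.Regular) (k : Fin M.p) : 0 < M.weight k :=
  Real.sqrt_pos.2 (Nat.cast_pos.2 (h.one_le_d k))

lemma nonempty (h : M.Regular) : Nonempty (Fin M.p) := by
  obtain ⟨k, -⟩ := Finset.card_pos.1 h.one_le_q
  exact ⟨k⟩

lemma one_le_db (h : M.Regular) : 1 ≤ M.db := by
  have := h.nonempty
  exact le_ciInf h.one_le_d

lemma db_le_da (h : M.Regular) : M.db ≤ M.da := by
  obtain ⟨k⟩ := h.nonempty
  exact (db_le_d k).trans (d_le_da k)

lemma one_le_db_real (h : M.Regular) : (1 : ℝ) ≤ M.db := by exact_mod_cast h.one_le_db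

lemma one_le_da_real (h : M.Regular) : (1 : ℝ) ≤ M.da := by
  exact_mod_cast h.one_le_db.trans h.db_le_da

lemma one_le_q_real (h : M.Regular) : (1 : ℝ) ≤ M.q := by exact_mod_cast h.one_le_q

lemma one_le_n_real (h : M.Regular) : (1 : ℝ) ≤ M.n := by exact_mod_cast h.one_le_n

lemma cUp_pos (h : M.Regular) : 0 < M.cUp := h.cLow_pos.trans h.cLow_lt

lemma one_le_dRatio (h : M.Regular) : 1 ≤ M.dRatio := by
  have := h.one_le_db_real
  rw [dRatio, le_div_iff₀ (by linarith), one_mul]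
  exact_mod_cast h.db_le_da

lemma one_le_cBar (h : M.Regular) : 1 ≤ M.cBar := by
  rw [cBar, le_div_iff₀ h.cLow_pos, one_mul]
  exact h.cLow_lt.le

lemma one_le_sqrt (h : M.Regular) : 1 ≤ √(M.dRatio * M.cBar) := by
  rw [Real.one_le_sqrt]
  exact one_le_mul_of_one_le_of_one_le h.one_le_dRatio h.one_le_cBar

lemma sq_sqrt (h : M.Regular) : √(M.dRatio * M.cBar) ^ 2 = M.dRatio * M.cBar :=
  Real.sq_sqrt (mul_nonneg (by linarith [h.one_le_dRatio]) (by linarith [h.one_le_cBar]))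

/-- The sparse Riesz bounds hold for all sets of at most `qStar` groups. -/
lemma src_of_card_le (h : M.Regular) {A : Finset (Fin M.p)} (hA : A.card ≤ M.qStar)
    (ν : M.Coef) :
    M.cLow * M.n * ∑ k ∈ A, ‖ν k‖ ^ 2 ≤ ‖∑ k ∈ A, M.design k (ν k)‖ ^ 2 ∧
      ‖∑ k ∈ A, M.design k (ν k)‖ ^ 2 ≤ M.cUp * M.n * ∑ k ∈ A, ‖ν k‖ ^ 2 := by
  -- `SRC` speaks of exactly `qStar` groups: enlarge A and pad the coefficients with zeros, which
  -- needs qStar ≤ p.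
  obtain ⟨A', hAA', hA'⟩ := Finset.exists_superset_card_eq hA (by simpa using h.qStar_le)
  have hs := h.src A' hA' fun k => if k ∈ A then ν k else 0
  have e1 : ∑ k ∈ A', ‖(if k ∈ A then ν k else 0 : EuclideanSpace ℝ (Fin (M.d k)))‖ ^ 2
      = ∑ k ∈ A, ‖ν k‖ ^ 2 := by
    rw [← Finset.sum_subset hAA' (fun k _ hk => by simp [hk])]
    exact Finset.sum_congr rfl fun k hk => by simp [hk]
  have e2 : M.partialFit A' (fun k => if k ∈ A then ν k else 0)
      = ∑ k ∈ A, M.design k (ν k) := by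
    rw [partialFit, ← Finset.sum_subset hAA' (fun k _ hk => by simp [hk])]
    exact Finset.sum_congr rfl fun k hk => by simp [hk, design]
  rw [e1, e2] at hs
  simpa only [mul_assoc] using hs

lemma sum_weight_mul_norm_le (h : M.Regular) :
    ∑ k ∈ (M.A₀ᶜ)ᶜ, M.weight k * ‖M.β k‖ ≤ √(M.da : ℝ) * M.η₁ := by
  rw [compl_compl]
  refine le_trans ?_ (mul_le_mul_of_nonneg_left h.gsc (Real.sqrt_nonneg _))
  rw [Finset.mul_sum]
  refine Finset.sum_le_sum fun k _ => mul_le_mul_of_nonneg_right ?_ (norm_nonneg _)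
  exact Real.sqrt_le_sqrt (Nat.cast_le.2 (d_le_da k))

end Regular

lemma norm_sum_compl_le {A : Finset (Fin M.p)} (hA : M.A₀ᶜ ⊆ A) :
    ‖∑ k ∈ Aᶜ, M.design k (M.β k)‖ ≤ M.η₂ := by
  have hmem : Aᶜ ∈ M.A₀.powerset := by
    rw [Finset.mem_powerset, ← compl_compl M.A₀]
    exact Finset.compl_subset_compl.2 hA
  exact Finset.le_sup' (fun A => ‖M.partialFit A M.β‖) hmem

lemma η₂_nonneg : 0 ≤ M.η₂ := by
  refine le_trans (norm_nonneg (M.partialFit ∅ M.β)) ?_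
  exact Finset.le_sup' (fun A => ‖M.partialFit A M.β‖) (Finset.empty_mem_powerset _)

lemma r₁_nonneg : 0 ≤ M.r₁ l := Real.sqrt_nonneg _

lemma r₂_nonneg : 0 ≤ M.r₂ l := Real.sqrt_nonneg _

/-- The natural scale of the prediction error. -/
noncomputable def scale (M : GroupModel) (l : ℝ) : ℝ := √(l ^ 2 * M.db * M.q / (M.n * M.cUp))

lemma scale_nonneg : 0 ≤ M.scale l := Real.sqrt_nonneg _

namespace Regular

lemma scale_sq (h : M.Regular) (l : ℝ) :
    M.n * M.cUp * M.scale l ^ 2 = l ^ 2 * M.db * M.q := by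
  have h1 := h.one_le_n_real
  have h2 := h.cUp_pos
  rw [scale, Real.sq_sqrt (by positivity)]
  field_simp

lemma B₁_sq (h : M.Regular) (l : ℝ) : M.B₁ l ^ 2 = M.db * M.scale l ^ 2 := by
  have h1 := h.one_le_n_real
  have h2 := h.cUp_pos
  rw [B₁, scale, Real.sq_sqrt (by positivity), Real.sq_sqrt (by positivity)]
  ring

lemma scale_sq_le (h : M.Regular) (l : ℝ) : M.scale l ^ 2 ≤ M.B₁ l ^ 2 := by
  rw [h.B₁_sq]
  exact le_mul_of_one_le_left (sq_nonneg _) h.one_le_db_real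

/-- This and the next two identities express each term of the basic inequality as a dimensionless
factor times a power of `scale`. -/
lemma r₁_sq_mul (h : M.Regular) (hl : 0 < l) :
    M.r₁ l ^ 2 * M.scale l ^ 2 = l * (√(M.da : ℝ) * M.η₁) := by
  have h1 := h.one_le_n_real
  have h2 := h.cUp_pos
  have h3 := h.one_le_db_real
  have h4 := h.one_le_q_real
  have h5 := h.eta_nonneg
  rw [r₁, scale, Real.sq_sqrt (by positivity), Real.sq_sqrt (by positivity)]
  field_simp

lemma r₂_mul (h : M.Regular) (hl : 0 < l) : M.r₂ l * M.scale l = M.η₂ := by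
  have h1 := h.one_le_n_real
  have h2 := h.cUp_pos
  have h3 := h.one_le_db_real
  have h4 := h.one_le_q_real
  rw [r₂, scale, ← Real.sqrt_mul (by positivity)]
  have : M.n * M.cUp * M.η₂ ^ 2 / (l ^ 2 * M.db * M.q) * (l ^ 2 * M.db * M.q / (M.n * M.cUp))
      = M.η₂ ^ 2 := by field_simp
  rw [this, Real.sqrt_sq η₂_nonneg]

lemma mul_sqrt_q (h : M.Regular) (hl : 0 < l) :
    l * √(M.da * M.q / (M.cLow * M.n)) = √(M.dRatio * M.cBar) * M.scale l := by
  have h1 := h.one_le_n_real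
  have h2 := h.cUp_pos
  have h3 := h.one_le_db_real
  have h4 := h.one_le_q_real
  have h5 := h.cLow_pos
  nth_rewrite 1 [← Real.sqrt_sq hl.le]
  rw [scale, ← Real.sqrt_mul (by positivity), ← Real.sqrt_mul (by
    have := h.one_le_dRatio
    have := h.one_le_cBar
    positivity), dRatio, cBar]
  congr 1
  field_simp

/-- Needed because the path argument uses one size bound for every penalty above the given one. -/
lemma antitone_M₁ (h : M.Regular) {l' : ℝ} (hl : 0 < l) (hll : l ≤ l') : M.M₁ l' ≤ M.M₁ l := by
  have h1 := h.one_le_n_real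
  have h2 := h.cUp_pos
  have h3 := h.one_le_db_real
  have h4 := h.one_le_q_real
  have h5 := h.eta_nonneg
  have e1 : M.r₁ l' ≤ M.r₁ l := by
    refine Real.sqrt_le_sqrt (div_le_div_of_nonneg_left (by positivity) (by positivity) ?_)
    gcongr
  have e2 : M.r₂ l' ≤ M.r₂ l := by
    refine Real.sqrt_le_sqrt (div_le_div_of_nonneg_left (by positivity) (by positivity) ?_)
    gcongr
  have e3 : 0 ≤ M.r₁ l' := r₁_nonneg
  rw [M₁, M₁]
  gcongr

lemma six_le_M₁ (h : M.Regular) (l : ℝ) : 6 ≤ M.M₁ l := by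
  have h1 := one_le_mul_of_one_le_of_one_le h.one_le_dRatio h.one_le_cBar
  have h2 : 0 ≤ √(M.dRatio * M.cBar) * M.r₂ l := mul_nonneg (Real.sqrt_nonneg _) r₂_nonneg
  rw [M₁]
  nlinarith [sq_nonneg (M.r₁ l)]

end Regular

end GroupModel

/-! ### Deterministic bounds under small noise -/

namespace GroupModel

open GroupLasso

variable {M : GroupModel} {l : ℝ}

/-- The error vector `e` has group scores bounded by `τ`, which is small compared to `l`. -/
structure SmallNoise (M : GroupModel) (l τ : ℝ) (e : EuclideanSpace ℝ (Fin M.n)) : Prop where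
  nonneg : 0 ≤ τ
  sq_le : 16 * (M.da * M.dRatio ^ 2 * M.qStar * M.cBar) * τ ^ 2 ≤ l ^ 2
  score_le : ∀ k, ‖LinearMap.adjoint (M.design k) e‖ ≤ τ * M.weight k

variable {τ : ℝ} {e : EuclideanSpace ℝ (Fin M.n)} {b : M.Coef} {A : Finset (Fin M.p)}

lemma SmallNoise.mono (hn : M.SmallNoise l τ e) (hl : 0 ≤ l) {l' : ℝ} (hll : l ≤ l') :
    M.SmallNoise l' τ e :=
  ⟨hn.nonneg, hn.sq_le.trans (pow_le_pow_left₀ hl hll 2), hn.score_le⟩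

lemma design_mem_colSpan {S : Finset (Fin M.p)} {k : Fin M.p} (hk : k ∈ S)
    (v : EuclideanSpace ℝ (Fin (M.d k))) : M.design k v ∈ M.colSpan S :=
  Submodule.mem_iSup_of_mem k (Submodule.mem_iSup_of_mem hk ⟨v, rfl⟩)

/-- The fit Xb lies in the selected span, so I − P̂ kills it and contracts what remains. -/
lemma omegaTilde_le (b : M.Coef) : M.omegaTilde b ≤ ‖pred M.design (M.β - b)‖ := by
  have hmem : pred M.design b ∈ M.colSpan (M.selected b) := by
    refine Submodule.sum_mem _ fun k _ => ?_
    by_cases hk : b k = 0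
    · rw [hk, map_zero]
      exact Submodule.zero_mem _
    · exact design_mem_colSpan (by simpa [selected] using hk) _
  set K := M.colSpan (M.selected b) with hK
  have e1 : M.fit M.β - K.starProjection (M.fit M.β)
      = Kᗮ.starProjection (pred M.design (M.β - b)) := by
    rw [Submodule.starProjection_orthogonal_val, pred_sub, map_sub,
      Submodule.starProjection_eq_self_iff.2 hmem]
    change pred M.design M.β - K.starProjection (pred M.design M.β) = _
    abel
  rw [omegaTilde, e1]
  exact Submodule.norm_starProjection_apply_le _ _

namespace Regular

lemma seven_le_qStar (h : M.Regular) (hM : M.M₁ l * M.q + 1 ≤ M.qStar) : (7 : ℝ) ≤ M.qStar := by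
  have h1 := h.six_le_M₁ l
  have h2 := h.one_le_q_real
  nlinarith

lemma noise_le (h : M.Regular) (hn : M.SmallNoise l τ e) :
    16 * (τ ^ 2 * M.da * M.qStar * M.cBar) ≤ l ^ 2 := by
  refine le_trans ?_ hn.sq_le
  have h1 := h.one_le_dRatio
  have h2 := h.one_le_cBar
  have h3 : (1 : ℝ) ≤ M.dRatio ^ 2 := one_le_pow₀ h1
  have h4 : 0 ≤ 16 * (τ ^ 2 * M.da * M.qStar * M.cBar) := by positivity
  calc 16 * (τ ^ 2 * M.da * M.qStar * M.cBar)
      ≤ 16 * (τ ^ 2 * M.da * M.qStar * M.cBar) * M.dRatio ^ 2 := le_mul_of_one_le_right h4 h3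
    _ = _ := by ring

/-- Since qStar ≥ 7, the noise bound gives l² ≥ 16·7·τ² ≥ 100τ². -/
lemma noise_le_tenth (h : M.Regular) (hl : 0 < l) (hM : M.M₁ l * M.q + 1 ≤ M.qStar)
    (hn : M.SmallNoise l τ e) : τ ≤ l / 10 := by
  have h1 := h.noise_le hn
  have h2 := h.one_le_cBar
  have h3 := h.one_le_da_real
  have h4 := h.seven_le_qStar hM
  have h5 : (7 : ℝ) ≤ M.da * M.qStar * M.cBar := by
    have : (1 : ℝ) * 7 * 1 ≤ M.da * M.qStar * M.cBar := by gcongr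
    linarith
  have h6 : τ ^ 2 ≤ (l / 10) ^ 2 := by nlinarith [sq_nonneg τ]
  exact (sq_le_sq₀ hn.nonneg (by positivity)).1 h6

/-- The factors q* and c̄ in the penalty pay for |A| and for replacing c_* by c*; the factor 16
becomes 1/4. -/
lemma noise_mul_sqrt_card_le (h : M.Regular) (hn : M.SmallNoise l τ e)
    (hA : A.card ≤ M.qStar) :
    τ * √(M.da * A.card / (M.cLow * M.n)) ≤ M.scale l / 4 := by
  have h1 := h.one_le_n_real
  have h2 := h.cUp_pos
  have h3 := h.one_le_db_real
  have h4 := h.one_le_q_real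
  have h5 := h.cLow_pos
  have hA' : (A.card : ℝ) ≤ M.qStar := by exact_mod_cast hA
  have h6 : (τ * √(M.da * A.card / (M.cLow * M.n))) ^ 2 ≤ (M.scale l / 4) ^ 2 := by
    rw [mul_pow, Real.sq_sqrt (by positivity), div_pow]
    refine le_of_mul_le_mul_left ?_ (show 0 < 16 * (M.n * M.cUp) by positivity)
    have e1 : 16 * (M.n * M.cUp) * (M.scale l ^ 2 / 4 ^ 2) = l ^ 2 * (M.db * M.q) := by
      rw [← mul_assoc (l ^ 2), ← h.scale_sq]; ring
    have e2 : 16 * (M.n * M.cUp) * (τ ^ 2 * (M.da * A.card / (M.cLow * M.n)))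
        = 16 * (τ ^ 2 * M.da * A.card * M.cBar) := by
      rw [cBar]; field_simp
    rw [e1, e2]
    have h7 : 16 * (τ ^ 2 * M.da * A.card * M.cBar) ≤ 16 * (τ ^ 2 * M.da * M.qStar * M.cBar) := by
      have := h.one_le_cBar
      gcongr
    refine (h7.trans (h.noise_le hn)).trans ?_
    exact le_mul_of_one_le_right (sq_nonneg _) (one_le_mul_of_one_le_of_one_le h3 h4)
  exact (sq_le_sq₀ (mul_nonneg hn.nonneg (Real.sqrt_nonneg _))
    (div_nonneg scale_nonneg (by norm_num))).1 h6

/-- The basic inequality, in terms of the natural scale of the prediction error. -/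
lemma basic_inequality (h : M.Regular) (hl : 0 < l) (hM : M.M₁ l * M.q + 1 ≤ M.qStar)
    (hn : M.SmallNoise l τ e) (hb : IsSol M.design M.weight (pred M.design M.β + e) l b)
    (hBA : M.A₀ᶜ ⊆ A) (hbA : b ∈ supported _ A) (hA : A.card ≤ M.qStar) :
    ‖pred M.design (M.β - b)‖ ^ 2 ≤ 11 / 10 * (M.r₁ l ^ 2 * M.scale l ^ 2)
      + (√(M.dRatio * M.cBar) * M.scale l + M.scale l / 4)
        * ‖∑ k ∈ A, M.design k ((M.β - b) k)‖ ∧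
    ‖∑ k ∈ A, M.design k ((M.β - b) k)‖
      ≤ ‖pred M.design (M.β - b)‖ + M.r₂ l * M.scale l := by
  have h1 := h.one_le_n_real
  have h5 := h.cLow_pos
  constructor
  · refine (sq_norm_pred_sub_le (fun k => weight_nonneg k) hl.le hb hBA hbA
      (W := M.da) (cl := M.cLow * M.n) (by positivity)
      (fun k => by rw [weight_sq]; exact_mod_cast d_le_da k)
      (fun ν => (h.src_of_card_le hA ν).1) hn.nonneg hn.score_le h.sum_weight_mul_norm_le).trans ?_
    refine add_le_add ?_ (mul_le_mul_of_nonneg_right (add_le_add ?_ ?_) (norm_nonneg _))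
    · rw [h.r₁_sq_mul hl]
      have h6 := h.noise_le_tenth hl hM hn
      have h7 : 0 ≤ √(M.da : ℝ) * M.η₁ := mul_nonneg (Real.sqrt_nonneg _) h.eta_nonneg
      nlinarith
    · exact (h.mul_sqrt_q hl).le
    · exact h.noise_mul_sqrt_card_le hn hA
  · rw [h.r₂_mul hl]
    exact (norm_sum_le_pred_add hbA).trans (add_le_add le_rfl (norm_sum_compl_le hBA))

lemma sq_pred_error_le (h : M.Regular) (hl : 0 < l) (hM : M.M₁ l * M.q + 1 ≤ M.qStar)
    (hn : M.SmallNoise l τ e) (hb : IsSol M.design M.weight (pred M.design M.β + e) l b)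
    (hBA : M.A₀ᶜ ⊆ A) (hbA : b ∈ supported _ A) (hA : A.card ≤ M.qStar) :
    ‖pred M.design (M.β - b)‖ ^ 2 ≤ (11 / 5 * M.r₁ l ^ 2 + 25 / 16 * (M.dRatio * M.cBar)
      + 5 / 2 * (√(M.dRatio * M.cBar) * M.r₂ l)) * M.scale l ^ 2 := by
  obtain ⟨h1, h2⟩ := h.basic_inequality hl hM hn hb hBA hbA hA
  have h3 := sq_le_of_basic scale_nonneg h.one_le_sqrt r₂_nonneg h1 h2 (norm_nonneg _)
  rwa [h.sq_sqrt] at h3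

lemma card_le_of_saturated (h : M.Regular) (hl : 0 < l) (hM : M.M₁ l * M.q + 1 ≤ M.qStar)
    (hn : M.SmallNoise l τ e) (hb : IsSol M.design M.weight (pred M.design M.β + e) l b)
    (hBA : M.A₀ᶜ ⊆ A) (hbA : b ∈ supported _ A)
    (hsat : ∀ k ∈ A, k ∉ M.A₀ᶜ →
      ‖score M.design (pred M.design M.β + e) b k‖ = l * M.weight k)
    (hA : A.card ≤ M.qStar) : (A.card : ℝ) ≤ M.M₁ l * M.q := by
  have h1 := h.one_le_n_real
  have h2 := h.cUp_pos
  have h3 := h.one_le_db_real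
  have h4 := h.one_le_q_real
  have hz := h.sq_pred_error_le hl hM hn hb hBA hbA hA
  set S := A \ M.A₀ᶜ with hS
  have hSA : S ⊆ A := Finset.sdiff_subset
  have hSq : S.card ≤ M.qStar := (Finset.card_le_card hSA).trans hA
  have hSq' : (S.card : ℝ) ≤ M.qStar := by exact_mod_cast hSq
  have hcard : (A.card : ℝ) = S.card + M.q := by
    have := Finset.card_sdiff_add_card_eq_card hBA
    rw [← hS] at this
    rw [← this, q]
    push_cast
    ring
  have hc := card_saturated_mul_le (β := M.β) (e := e) (S := S) (cu := M.cUp * M.n) (W := M.da)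
    (w₀ := M.db) hl.le (by positivity)
    (fun k => weight_nonneg k) (fun k => by rw [weight_sq]; exact_mod_cast d_le_da k)
    (fun k => by rw [weight_sq]; exact_mod_cast db_le_d k)
    (fun ν => (h.src_of_card_le hSq ν).2) hn.score_le
    (fun k hk => hsat k (hSA hk) (Finset.mem_sdiff.1 hk).2)
  have hnoise : 16 * (τ ^ 2 * M.da * S.card) ≤ l ^ 2 * M.db * M.q := by
    have h6 : 16 * (τ ^ 2 * M.da * S.card) ≤ 16 * (τ ^ 2 * M.da * M.qStar * M.cBar) := by
      have h7 : τ ^ 2 * M.da * S.card ≤ τ ^ 2 * M.da * M.qStar := by gcongr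
      have h8 : τ ^ 2 * M.da * M.qStar ≤ τ ^ 2 * M.da * M.qStar * M.cBar :=
        le_mul_of_one_le_right (by positivity) h.one_le_cBar
      linarith
    refine (h6.trans (h.noise_le hn)).trans ?_
    rw [mul_assoc]
    exact le_mul_of_one_le_right (sq_nonneg _) (one_le_mul_of_one_le_of_one_le h3 h4)
  have hz' := mul_le_mul_of_nonneg_left hz (show 0 ≤ M.cUp * M.n by positivity)
  have hsc : M.cUp * M.n * M.scale l ^ 2 = l ^ 2 * M.db * M.q := by
    rw [← h.scale_sq]; ring
  set K := 11 / 5 * M.r₁ l ^ 2 + 25 / 16 * (M.dRatio * M.cBar)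
      + 5 / 2 * (√(M.dRatio * M.cBar) * M.r₂ l) with hK
  have hz'' : M.cUp * M.n * ‖pred M.design (M.β - b)‖ ^ 2 ≤ K * (l ^ 2 * M.db * M.q) := by
    rw [← hsc]; linarith
  have hfin : l ^ 2 * M.db * S.card ≤ l ^ 2 * M.db * ((3 / 2 * K + 3 / 16) * M.q) := by
    linarith
  have hS' : (S.card : ℝ) ≤ (3 / 2 * K + 3 / 16) * M.q :=
    le_of_mul_le_mul_left hfin (by positivity)
  -- The 1 counts the important groups and 3/16 is the noise share.
  have hKM : 3 / 2 * K + 3 / 16 + 1 ≤ M.M₁ l := by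
    have h6 : 0 ≤ √(M.dRatio * M.cBar) * M.r₂ l := mul_nonneg (Real.sqrt_nonneg _) r₂_nonneg
    have h7 := one_le_mul_of_one_le_of_one_le h.one_le_dRatio h.one_le_cBar
    rw [hK, M₁]
    nlinarith [sq_nonneg (M.r₁ l)]
  have := mul_le_mul_of_nonneg_right hKM (show (0 : ℝ) ≤ M.q by positivity)
  rw [hcard]
  linarith

/-- The sparsity bound for all group Lasso solutions. -/
lemma exists_sparse_superset (h : M.Regular) (hl : 0 < l) (hM : M.M₁ l * M.q + 1 ≤ M.qStar)
    (hn : M.SmallNoise l τ e) (hb : IsSol M.design M.weight (pred M.design M.β + e) l b) :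
    ∃ A, M.A₀ᶜ ⊆ A ∧ b ∈ supported _ A ∧ A.card ≤ M.qStar ∧ (A.card : ℝ) ≤ M.M₁ l * M.q := by
  have hq := h.one_le_q_real
  have h6 := h.six_le_M₁ l
  have h0 : 0 ≤ M.M₁ l * M.q := by positivity
  -- The extra 1 in M₁q + 1 ≤ q* lets the Riesz condition cover the sets of m + 1 groups in the path
  -- argument.
  have hfl : ⌊M.M₁ l * M.q⌋₊ + 1 ≤ M.qStar := by
    have := Nat.floor_le h0
    have h7 : ((⌊M.M₁ l * M.q⌋₊ + 1 : ℕ) : ℝ) ≤ M.qStar := by push_cast; linarith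
    exact_mod_cast h7
  obtain ⟨A, hBA, -, hbA, hA⟩ := card_support_le_of_path (m := ⌊M.M₁ l * M.q⌋₊)
    (fun k => h.weight_pos k) hl (B := M.A₀ᶜ)
    (Nat.le_floor (by
      change (M.q : ℝ) ≤ _
      nlinarith))
    (fun l' hll b' hb' A' hBA' hbA' hsat hA' => by
      have hl' : 0 < l' := hl.trans_le hll
      have hM1 := mul_le_mul_of_nonneg_right (h.antitone_M₁ hl hll)
        (show (0 : ℝ) ≤ M.q by positivity)
      refine Nat.le_floor ((h.card_le_of_saturated hl' (by linarith) (hn.mono hl.le hll) hb' hBA'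
        hbA' hsat (hA'.trans hfl)).trans hM1)) hb
  exact ⟨A, hBA, hbA, by omega, (Nat.cast_le.2 hA).trans (Nat.floor_le h0)⟩

/-- On an unselected group β − b equals β, so the lower Riesz bound applies. -/
lemma zeta2_sq_le (h : M.Regular) (hBA : M.A₀ᶜ ⊆ A) (hA : A.card ≤ M.qStar) :
    M.cLow * M.n * M.zeta2 b ^ 2 ≤ ‖∑ k ∈ A, M.design k ((M.β - b) k)‖ ^ 2 := by
  have h1 := h.cLow_pos
  refine le_trans (mul_le_mul_of_nonneg_left ?_ (by positivity)) (h.src_of_card_le hA _).1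
  rw [zeta2, Real.sq_sqrt (Finset.sum_nonneg fun k _ => by positivity)]
  refine (Finset.sum_le_sum fun k _ => ?_).trans
    (Finset.sum_le_sum_of_subset_of_nonneg hBA fun _ _ _ => sq_nonneg _)
  by_cases hk : ‖b k‖ = 0
  · simp [norm_eq_zero.1 hk]
  · simp [hk]

/-- The conclusions of the theorem hold whenever the noise is small. -/
theorem bounds_of_smallNoise (h : M.Regular) (hl : 0 < l) (hM : M.M₁ l * M.q + 1 ≤ M.qStar)
    (hn : M.SmallNoise l τ e) (hb : IsSol M.design M.weight (pred M.design M.β + e) l b) :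
    (M.selected b).card ≤ (Finset.univ.filter fun k => 0 < ‖b k‖ ∨ k ∉ M.A₀).card ∧
    ((Finset.univ.filter fun k => 0 < ‖b k‖ ∨ k ∉ M.A₀).card : ℝ) ≤ M.M₁ l * M.q ∧
    M.omegaTilde b ^ 2 ≤ M.M₂ l * M.B₁ l ^ 2 ∧
    M.zeta2 b ^ 2 ≤ M.M₃ l * M.B₁ l ^ 2 / (M.cLow * M.n) := by
  have h1 := h.one_le_n_real
  have h2 := h.cLow_pos
  have hd := h.one_le_dRatio
  have hc := h.one_le_cBar
  have hdc := one_le_mul_of_one_le_of_one_le hd hc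
  have hr₂ : 0 ≤ M.r₂ l := r₂_nonneg
  have har : 0 ≤ √(M.dRatio * M.cBar) * M.r₂ l := mul_nonneg (Real.sqrt_nonneg _) hr₂
  obtain ⟨A, hBA, hbA, hA, hcard⟩ := h.exists_sparse_superset hl hM hn hb
  refine ⟨?_, ?_, ?_, ?_⟩
  · refine Finset.card_le_card fun k hk => ?_
    have hk' := (Finset.mem_filter.1 hk).2
    exact Finset.mem_filter.2 ⟨Finset.mem_univ _, Or.inl hk'⟩
  · refine le_trans (Nat.cast_le.2 (Finset.card_le_card fun k hk => ?_)) hcard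
    rcases (Finset.mem_filter.1 hk).2 with hk' | hk'
    · by_contra hkA
      rw [hbA k hkA, norm_zero] at hk'
      exact lt_irrefl _ hk'
    · exact hBA (Finset.mem_compl.2 hk')
  · refine (pow_le_pow_left₀ (norm_nonneg _) (omegaTilde_le b) 2).trans ?_
    refine (h.sq_pred_error_le hl hM hn hb hBA hbA hA).trans ?_
    have hM₂ : 11 / 5 * M.r₁ l ^ 2 + 25 / 16 * (M.dRatio * M.cBar)
        + 5 / 2 * (√(M.dRatio * M.cBar) * M.r₂ l) ≤ M.M₂ l := by
      have h3 : M.dRatio * M.cBar ≤ M.dRatio * M.cBar ^ 2 := by nlinarith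
      have h4 : 2 * (√(M.dRatio * M.cBar) * M.r₂ l)
          ≤ √(2 * M.dRatio) * (1 + √M.cBar) * √M.cBar * M.r₂ l := by
        have h5 : √(M.dRatio * M.cBar) ≤ √(2 * M.dRatio) * √M.cBar := by
          rw [← Real.sqrt_mul (by positivity)]
          exact Real.sqrt_le_sqrt (by nlinarith)
        have h6 : 1 ≤ √M.cBar := Real.one_le_sqrt.2 hc
        have h7 : 0 ≤ √(2 * M.dRatio) * √M.cBar := by positivity
        have h8 : 2 * √(M.dRatio * M.cBar) ≤ √(2 * M.dRatio) * (1 + √M.cBar) * √M.cBar := by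
          nlinarith
        have := mul_le_mul_of_nonneg_right h8 hr₂
        linarith
      rw [M₂]
      nlinarith [sq_nonneg (M.r₁ l)]
    have hM₂' : 0 ≤ M.M₂ l := le_trans (by positivity) hM₂
    exact mul_le_mul hM₂ (h.scale_sq_le l) (sq_nonneg _) hM₂'
  · obtain ⟨hb1, hb2⟩ := h.basic_inequality hl hM hn hb hBA hbA hA
    have hy := sq_le_of_basic' scale_nonneg h.one_le_sqrt r₂_nonneg hb1 hb2 (norm_nonneg _)
    rw [le_div_iff₀ (by positivity), mul_comm]
    refine ((h.zeta2_sq_le hBA hA).trans hy).trans ?_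
    rw [h.sq_sqrt]
    -- The constants on the left are those of `M₃` after using c̄ ≥ 1 in 7 + 4c̄ and √(1 + c̄) ≥ 1.
    have hM₃ : 2 / 3 + 8 / 3 * M.r₁ l ^ 2 + 44 / 9 * (M.dRatio * M.cBar)
        + 8 * (√(M.dRatio * M.cBar) * M.r₂ l) + 2 * M.r₂ l ^ 2 ≤ M.M₃ l := by
      have h3 : M.dRatio * M.cBar ≤ M.dRatio * M.cBar * M.cBar := by nlinarith
      have h4 : 1 ≤ √(1 + M.cBar) := Real.one_le_sqrt.2 (by linarith)
      have h5 : √(M.dRatio * M.cBar) * M.r₂ l ≤ √(M.dRatio * M.cBar) * M.r₂ l * √(1 + M.cBar) :=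
        le_mul_of_one_le_right har h4
      rw [M₃]
      linarith
    have hM₃' : 0 ≤ M.M₃ l := le_trans (by positivity) hM₃
    exact mul_le_mul hM₃ (h.scale_sq_le l) (sq_nonneg _) hM₃'

end Regular

end GroupModel

/-! ### Gaussian tails -/

/-- Two-sided tail bound for a linear combination of independent centered Gaussian variables. -/
lemma measureReal_abs_sum_gaussian_gt_le {Ω : Type*} [MeasurableSpace Ω] {μ : Measure Ω}
    [IsProbabilityMeasure μ] {n : ℕ} {ε : Fin n → Ω → ℝ} {σ V L : ℝ} (hσ : 0 < σ) (hL : 0 ≤ L)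
    (hεm : ∀ i, Measurable (ε i)) (hεi : iIndepFun ε μ)
    (hεl : ∀ i, μ.map (ε i) = gaussianReal 0 (Real.toNNReal (σ ^ 2)))
    (x : Fin n → ℝ) (hx : ∑ i, x i ^ 2 ≤ V) :
    μ.real {ω | σ * √(2 * V * L) < |∑ i, x i * ε i ω|} ≤ 2 * Real.exp (-L) := by
  have hS0 : 0 ≤ ∑ i, x i ^ 2 := Finset.sum_nonneg fun _ _ => sq_nonneg _
  have hV : 0 ≤ V := hS0.trans hx
  set s := σ * √(2 * V * L) with hs
  have hs0 : 0 ≤ s := by positivity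
  -- With x = 0 the sub-Gaussian exponent would divide by zero; the strict inequality makes the
  -- event empty.
  rcases hS0.eq_or_lt with h | h
  · have hx0 : ∀ i, x i = 0 := by
      intro i
      have := (Finset.sum_eq_zero_iff_of_nonneg fun i _ => sq_nonneg (x i)).1 h.symm i
        (Finset.mem_univ i)
      exact pow_eq_zero_iff two_ne_zero |>.1 this
    have he : {ω | s < |∑ i, x i * ε i ω|} = ∅ := by
      ext ω
      simp [hx0, hs0]
    rw [he, measureReal_empty]
    positivity
  · have hsub : ∀ i, HasSubgaussianMGF (ε i) (Real.toNNReal (σ ^ 2)) μ := fun i =>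
      { integrable_exp_mul := fun t => by
          have := integrable_exp_mul_gaussianReal (μ := 0) (v := Real.toNNReal (σ ^ 2)) t
          rw [← hεl i] at this
          exact this.comp_measurable (hεm i)
        mgf_le := fun t => by
          rw [mgf_gaussianReal (hεl i)]
          simp }
    have hone : ∀ y : Fin n → ℝ, ∑ i, y i ^ 2 = ∑ i, x i ^ 2 →
        μ.real {ω | s ≤ ∑ i, y i * ε i ω} ≤ Real.exp (-L) := by
      intro y hy
      have hind : iIndepFun (fun i ω => y i * ε i ω) μ :=
        hεi.comp (fun i z => y i * z) fun i => measurable_const_mul _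
      have hsub' : ∀ i, HasSubgaussianMGF (fun ω => y i * ε i ω)
          (Real.toNNReal (y i ^ 2) * Real.toNNReal (σ ^ 2)) μ := by
        intro i
        rw [Real.toNNReal_of_nonneg (sq_nonneg (y i))]
        exact (hsub i).const_mul (y i)
      have hb := HasSubgaussianMGF.measure_sum_ge_le_of_iIndepFun hind (s := Finset.univ)
        (fun i _ => hsub' i) hs0
      refine hb.trans (Real.exp_le_exp.2 ?_)
      have hc : ((∑ i, Real.toNNReal (y i ^ 2) * Real.toNNReal (σ ^ 2) : NNReal) : ℝ)
          = (∑ i, x i ^ 2) * σ ^ 2 := by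
        push_cast
        rw [← hy, Finset.sum_mul]
        refine Finset.sum_congr rfl fun i _ => ?_
        rw [Real.coe_toNNReal _ (sq_nonneg _), Real.coe_toNNReal _ (sq_nonneg _)]
      have hs2 : s ^ 2 = σ ^ 2 * (2 * V * L) := by
        rw [hs, mul_pow, Real.sq_sqrt (by positivity)]
      have : L ≤ s ^ 2 / (2 * ((∑ i, x i ^ 2) * σ ^ 2)) := by
        rw [le_div_iff₀ (by positivity), hs2]
        have := mul_le_mul_of_nonneg_right hx (show 0 ≤ 2 * L * σ ^ 2 by positivity)
        linarith
      rw [neg_div, neg_le_neg_iff, hc]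
      exact this
    have h1 := hone x rfl
    have h2 := hone (fun i => -x i) (by simp)
    have hsubset : {ω | s < |∑ i, x i * ε i ω|}
        ⊆ {ω | s ≤ ∑ i, x i * ε i ω} ∪ {ω | s ≤ ∑ i, -x i * ε i ω} := by
      intro ω hω
      have hω : s < |∑ i, x i * ε i ω| := hω
      rcases lt_abs.1 hω with h3 | h3
      · exact Or.inl h3.le
      · refine Or.inr ?_
        change s ≤ _
        simp only [neg_mul, Finset.sum_neg_distrib]
        exact h3.le
    have h3 := (measureReal_mono (μ := μ) hsubset).trans (measureReal_union_le _ _)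
    linarith

/-! ### The noise event and the penalty level -/

namespace GroupModel

open GroupLasso

variable {M : GroupModel} {l : ℝ}

lemma inner_design_single (k : Fin M.p) (j : Fin (M.d k)) (e : Fin M.n → ℝ) :
    inner ℝ (M.design k (EuclideanSpace.single j 1)) (WithLp.toLp 2 e)
      = ∑ i, M.X k i j * e i := by
  simp [design, Matrix.toEuclideanLin, PiLp.inner_apply, mul_comm]

lemma sq_norm_design_single (k : Fin M.p) (j : Fin (M.d k)) :
    ‖M.design k (EuclideanSpace.single j 1)‖ ^ 2 = ∑ i, M.X k i j ^ 2 := by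
  simp [design, Matrix.toEuclideanLin, EuclideanSpace.real_norm_sq_eq]

/-- A uniform bound on d_k coordinates costs √d_k in Euclidean norm, which is precisely the penalty
weight. -/
lemma norm_adjoint_design_le {k : Fin M.p} {e : Fin M.n → ℝ} {s : ℝ} (hs : 0 ≤ s)
    (h : ∀ j, |∑ i, M.X k i j * e i| ≤ s) :
    ‖LinearMap.adjoint (M.design k) (WithLp.toLp 2 e)‖ ≤ s * M.weight k := by
  have hc : ∀ j, (LinearMap.adjoint (M.design k) (WithLp.toLp 2 e)) j = ∑ i, M.X k i j * e i := by
    intro j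
    rw [← inner_design_single, ← LinearMap.adjoint_inner_right, EuclideanSpace.inner_single_left]
    simp
  refine (sq_le_sq₀ (norm_nonneg _) (mul_nonneg hs (weight_nonneg k))).1 ?_
  rw [EuclideanSpace.real_norm_sq_eq, mul_pow, weight_sq]
  refine (Finset.sum_le_sum fun j _ => (?_ : _ ≤ s ^ 2)).trans_eq (by simp [mul_comm])
  rw [hc j]
  exact sq_le_sq' (neg_le_of_abs_le (h j)) (le_of_abs_le (h j))

/-- The level below which all column scores of the noise stay with high probability. -/
noncomputable def noiseLevel (M : GroupModel) : ℝ :=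
  M.σ * √(2 * (M.cUp * M.n) * ((1 + M.c₀) * Real.log M.NdMax))

lemma continuousAt_M₁ (h : M.Regular) (hl : 0 < l) : ContinuousAt M.M₁ l := by
  have h3 := h.one_le_db_real
  have h4 := h.one_le_q_real
  have e1 : l * M.db * M.q ≠ 0 := by positivity
  have e2 : l ^ 2 * M.db * M.q ≠ 0 := by positivity
  unfold M₁ r₁ r₂
  fun_prop (disch := assumption)

namespace Regular

/-- Monotonicity of `M₁` gives the condition strictly to the right of the infimum; right limits by
continuity give it at the infimum too. -/
lemma qStar_bound_of_lam0_le (h : M.Regular) (hl : 0 < l) (h0 : M.lam0 ≤ (l : EReal)) :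
    M.M₁ l * M.q + 1 ≤ M.qStar := by
  have hq := h.one_le_q_real
  have key : ∀ l', l < l' → M.M₁ l' * M.q + 1 ≤ M.qStar := by
    intro l' hl'
    have h1 : M.lam0 < (l' : EReal) := h0.trans_lt (EReal.coe_lt_coe_iff.2 hl')
    obtain ⟨_, ⟨l'', ⟨hl''0, hl''⟩, rfl⟩, hlt⟩ := sInf_lt_iff.1 h1
    have h2 := h.antitone_M₁ hl''0 (EReal.coe_lt_coe_iff.1 hlt).le
    have h3 := mul_le_mul_of_nonneg_right h2 (show (0 : ℝ) ≤ M.q by positivity)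
    linarith
  have hc : Tendsto (fun l' => M.M₁ l' * M.q + 1) (𝓝[>] l) (𝓝 (M.M₁ l * M.q + 1)) :=
    (((continuousAt_M₁ h hl).tendsto.mul_const _).add_const _).mono_left nhdsWithin_le_nhds
  exact le_of_tendsto hc (eventually_nhdsWithin_of_forall key)

lemma p_le_Nd (h : M.Regular) : M.p ≤ M.Nd := by
  have := Finset.sum_le_sum fun k (_ : k ∈ Finset.univ) => h.one_le_d k
  simpa [Nd] using this

lemma one_le_NdMax (h : M.Regular) : 1 ≤ M.NdMax := by
  refine le_max_of_le_left ?_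
  obtain ⟨k⟩ := h.nonempty
  have h1 : 1 ≤ M.Nd := (Nat.one_le_iff_ne_zero.2 (by have := k.2; omega)).trans h.p_le_Nd
  exact_mod_cast h1

lemma seven_le_qStar_of_lam0 (h : M.Regular) (h0 : M.lam0 ≤ (l : EReal)) :
    (7 : ℝ) ≤ M.qStar := by
  have h1 : M.lam0 < ⊤ := h0.trans_lt (EReal.coe_lt_top l)
  obtain ⟨_, ⟨l', ⟨-, hl'⟩, rfl⟩, -⟩ := sInf_lt_iff.1 h1
  exact h.seven_le_qStar hl'

/-- Positivity of the penalty is not assumed; it comes from log N_d > 0, since N_d ≥ p ≥ qStar ≥ 7.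
-/
lemma lamNP_pos (h : M.Regular) (hσ : 0 < M.σ) (hc₀ : 0 ≤ M.c₀) (hq : (7 : ℝ) ≤ M.qStar) :
    0 < M.lamNP := by
  have h1 := h.one_le_n_real
  have h2 := h.cUp_pos
  have h3 := h.one_le_da_real
  have h4 := h.one_le_dRatio
  have h5 := h.one_le_cBar
  have h6 : 1 < M.NdMax := by
    refine lt_max_of_lt_left ?_
    have h7 : (M.qStar : ℝ) ≤ M.Nd := by exact_mod_cast h.qStar_le.trans h.p_le_Nd
    linarith
  have h8 := Real.log_pos h6
  unfold lamNP
  positivity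

lemma smallNoise (h : M.Regular) (hσ : 0 < M.σ) (hc₀ : 0 ≤ M.c₀) (hl : M.lamNP ≤ l)
    {e : Fin M.n → ℝ} (he : ∀ k j, |∑ i, M.X k i j * e i| ≤ M.noiseLevel) :
    M.SmallNoise l M.noiseLevel (WithLp.toLp 2 e) := by
  have h0 : 0 ≤ M.noiseLevel := mul_nonneg hσ.le (Real.sqrt_nonneg _)
  refine ⟨h0, ?_, fun k => norm_adjoint_design_le h0 (he k)⟩
  have h1 := h.one_le_n_real
  have h2 := h.cUp_pos
  have h4 := h.one_le_dRatio
  have h5 := h.one_le_cBar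
  have h8 := Real.log_nonneg h.one_le_NdMax
  have h9 : 0 ≤ M.lamNP := mul_nonneg (by positivity) (Real.sqrt_nonneg _)
  -- An exact match: 2²·8 from `lamNP` equals 16·2 from `noiseLevel`.
  refine le_trans (le_of_eq ?_) (pow_le_pow_left₀ h9 hl 2)
  rw [noiseLevel, lamNP, mul_pow, mul_pow, Real.sq_sqrt (by positivity),
    Real.sq_sqrt (by positivity)]
  ring

/-- A column is the image of a unit vector in a single group, so the upper Riesz bound limits its
length. -/
lemma sum_sq_column_le (h : M.Regular) (hq : 1 ≤ M.qStar) (k : Fin M.p) (j : Fin (M.d k)) :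
    ∑ i, M.X k i j ^ 2 ≤ M.cUp * M.n := by
  have hs := (h.src_of_card_le (A := {k}) (by simpa using hq)
    (Pi.single k (EuclideanSpace.single j 1))).2
  simpa [sq_norm_design_single] using hs

/-- The probability that some column score of the noise is large. -/
lemma measureReal_exists_large_le (h : M.Regular) (hσ : 0 < M.σ) (hc₀ : 0 ≤ M.c₀)
    (hq : 1 ≤ M.qStar) {Ω : Type*} [MeasurableSpace Ω] {μ : Measure Ω} [IsProbabilityMeasure μ]
    {ε : Fin M.n → Ω → ℝ} (hεm : ∀ i, Measurable (ε i)) (hεi : iIndepFun ε μ)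
    (hεl : ∀ i, μ.map (ε i) = gaussianReal 0 (Real.toNNReal (M.σ ^ 2))) :
    μ.real {ω | ∀ k j, |∑ i, M.X k i j * ε i ω| ≤ M.noiseLevel}ᶜ
      ≤ 2 * (M.p * M.da / M.NdMax ^ (1 + M.c₀)) := by
  have hN := h.one_le_NdMax
  have hL : 0 ≤ (1 + M.c₀) * Real.log M.NdMax :=
    mul_nonneg (by linarith) (Real.log_nonneg hN)
  have hexp : Real.exp (-((1 + M.c₀) * Real.log M.NdMax)) = (M.NdMax ^ (1 + M.c₀))⁻¹ := by
    rw [Real.exp_neg, Real.rpow_def_of_pos (by linarith), mul_comm]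
  have hset : {ω | ∀ k j, |∑ i, M.X k i j * ε i ω| ≤ M.noiseLevel}ᶜ
      = ⋃ k, ⋃ j, {ω | M.noiseLevel < |∑ i, M.X k i j * ε i ω|} := by
    ext ω; simp
  have hcol : ∀ k j, μ.real {ω | M.noiseLevel < |∑ i, M.X k i j * ε i ω|}
      ≤ 2 * (M.NdMax ^ (1 + M.c₀))⁻¹ := by
    intro k j
    rw [← hexp]
    exact measureReal_abs_sum_gaussian_gt_le hσ hL hεm hεi hεl (fun i => M.X k i j)
      (h.sum_sq_column_le hq k j)
  have hpos : 0 ≤ 2 * (M.NdMax ^ (1 + M.c₀))⁻¹ := by positivity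
  rw [hset]
  calc μ.real (⋃ k, ⋃ j, {ω | M.noiseLevel < |∑ i, M.X k i j * ε i ω|})
      ≤ ∑ k, μ.real (⋃ j, {ω | M.noiseLevel < |∑ i, M.X k i j * ε i ω|}) :=
        measureReal_iUnion_fintype_le _
    _ ≤ ∑ k, ∑ j, μ.real {ω | M.noiseLevel < |∑ i, M.X k i j * ε i ω|} :=
        Finset.sum_le_sum fun k _ => measureReal_iUnion_fintype_le _
    _ ≤ ∑ k : Fin M.p, ∑ _j : Fin (M.d k), 2 * (M.NdMax ^ (1 + M.c₀))⁻¹ :=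
        Finset.sum_le_sum fun k _ => Finset.sum_le_sum fun j _ => hcol k j
    _ = ∑ k : Fin M.p, M.d k * (2 * (M.NdMax ^ (1 + M.c₀))⁻¹) := by simp
    _ ≤ ∑ _k : Fin M.p, M.da * (2 * (M.NdMax ^ (1 + M.c₀))⁻¹) :=
        Finset.sum_le_sum fun k _ => mul_le_mul_of_nonneg_right
          (Nat.cast_le.2 (d_le_da k)) hpos
    _ = 2 * (M.p * M.da / M.NdMax ^ (1 + M.c₀)) := by
        simp only [Finset.sum_const, Finset.card_univ, Fintype.card_fin, nsmul_eq_mul]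
        ring

end Regular

end GroupModel

/-! ### Assembly along the sequence -/

theorem theorem1
    -- a sequence of problems; every quantity may change along the sequence
    (M : ℕ → GroupModel)
    {Ω : ℕ → Type*} [∀ t, MeasurableSpace (Ω t)]
    (μ : ∀ t, Measure (Ω t)) [∀ t, IsProbabilityMeasure (μ t)]
    (ε : ∀ t, Fin (M t).n → Ω t → ℝ)
    (lam : ℕ → ℝ)
    -- ranges of the quantities
    (hn : ∀ t, 1 ≤ (M t).n)
    (hd : ∀ t k, 1 ≤ (M t).d k)
    (hq : ∀ t, 1 ≤ (M t).q)
    (hqStar : ∀ t, (M t).qStar ≤ (M t).p)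
    (hη : ∀ t, 0 ≤ (M t).η₁)
    (hcLow : ∀ t, 0 < (M t).cLow)
    (hcUp : ∀ t, (M t).cLow < (M t).cUp)
    (hσ : ∀ t, 0 < (M t).σ)
    (hc₀ : ∀ t, 0 ≤ (M t).c₀)
    (ha : ∀ t, 0 ≤ (M t).a)
    (hlim : Tendsto
      (fun t => ((M t).p : ℝ) * (M t).da / (M t).NdMax ^ (1 + (M t).c₀)) atTop (𝓝 0))
    -- independent Gaussian errors
    (hεm : ∀ t i, Measurable (ε t i))
    (hεi : ∀ t, iIndepFun (ε t) (μ t))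
    (hεl : ∀ t i, (μ t).map (ε t i) = gaussianReal 0 (Real.toNNReal ((M t).σ ^ 2)))
    -- generalized sparsity and sparse Riesz conditions
    (hGSC : ∀ t, (M t).GSC)
    (hSRC : ∀ t, (M t).SRC)
    -- the constraint on the penalty level
    (hlam : ∀ t, max (M t).lam0 ((M t).lamNP : EReal) ≤ (lam t : EReal)) :
    -- the bounds hold, for every group Lasso estimate, on events of probability tending to 1
    ∃ E : ∀ t, Set (Ω t),
      (∀ t, MeasurableSet (E t)) ∧
      Tendsto (fun t => μ t (E t)) atTop (𝓝 1) ∧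
      ∀ t, ∀ ω ∈ E t, ∀ b : (M t).Coef,
        (M t).IsGroupLasso ((M t).response fun i => ε t i ω) (lam t) b →
          ((M t).selected b).card
              ≤ (Finset.univ.filter fun k => 0 < ‖b k‖ ∨ k ∉ (M t).A₀).card ∧
          ((Finset.univ.filter fun k => 0 < ‖b k‖ ∨ k ∉ (M t).A₀).card : ℝ)
              ≤ (M t).M₁ (lam t) * (M t).q ∧
          (M t).omegaTilde b ^ 2 ≤ (M t).M₂ (lam t) * (M t).B₁ (lam t) ^ 2 ∧
          (M t).zeta2 b ^ 2
              ≤ (M t).M₃ (lam t) * (M t).B₁ (lam t) ^ 2 / ((M t).cLow * (M t).n) := by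
  have hreg : ∀ t, (M t).Regular := fun t =>
    ⟨hn t, hd t, hq t, hqStar t, hη t, hcLow t, hcUp t, hGSC t, hSRC t⟩
  have h0 : ∀ t, (M t).lam0 ≤ (lam t : EReal) := fun t => (le_max_left _ _).trans (hlam t)
  have hNP : ∀ t, (M t).lamNP ≤ lam t := fun t =>
    EReal.coe_le_coe_iff.1 ((le_max_right _ _).trans (hlam t))
  have h7 : ∀ t, (7 : ℝ) ≤ (M t).qStar := fun t => (hreg t).seven_le_qStar_of_lam0 (h0 t)
  have hq1 : ∀ t, 1 ≤ (M t).qStar := fun t => by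
    have : (1 : ℝ) ≤ (M t).qStar := by linarith [h7 t]
    exact_mod_cast this
  have hpos : ∀ t, 0 < lam t := fun t =>
    ((hreg t).lamNP_pos (hσ t) (hc₀ t) (h7 t)).trans_le (hNP t)
  have hmeas : ∀ t, MeasurableSet
      {ω | ∀ k j, |∑ i, (M t).X k i j * ε t i ω| ≤ (M t).noiseLevel} := by
    intro t
    simp only [Set.ofPred_forall]
    refine MeasurableSet.iInter fun k => MeasurableSet.iInter fun j => ?_
    have := hεm t
    exact measurableSet_le (by fun_prop) measurable_const
  refine ⟨fun t => {ω | ∀ k j, |∑ i, (M t).X k i j * ε t i ω| ≤ (M t).noiseLevel}, hmeas, ?_, ?_⟩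
  · have hbound := fun t => (hreg t).measureReal_exists_large_le (hσ t) (hc₀ t) (hq1 t)
      (hεm t) (hεi t) (hεl t)
    have hreal : Tendsto (fun t => (μ t).real
        {ω | ∀ k j, |∑ i, (M t).X k i j * ε t i ω| ≤ (M t).noiseLevel}) atTop (𝓝 1) := by
      have hlow : Tendsto (fun t => 1 - 2 * (((M t).p : ℝ) * (M t).da
          / (M t).NdMax ^ (1 + (M t).c₀))) atTop (𝓝 1) := by
        simpa using (hlim.const_mul 2).const_sub 1
      refine tendsto_of_tendsto_of_tendsto_of_le_of_le hlow tendsto_const_nhds (fun t => ?_)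
        fun t => measureReal_le_one
      have h1 := hbound t
      rw [probReal_compl_eq_one_sub (hmeas t)] at h1
      change _ ≤ (μ t).real _
      linarith
    have h2 := (ENNReal.continuous_ofReal.tendsto 1).comp hreal
    rw [ENNReal.ofReal_one] at h2
    exact h2.congr fun t => ofReal_measureReal
  · intro t ω hω b hb
    have hM := (hreg t).qStar_bound_of_lam0_le (hpos t) (h0 t)
    exact (hreg t).bounds_of_smallNoise (hpos t) hM
      ((hreg t).smallNoise (hσ t) (hc₀ t) (hNP t) hω) (GroupModel.isGroupLasso_iff.1 hb)
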